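/- A tournament $T$ is a complete graph in which every edge is given exactly one direction; $\vec{uv}$ denotes an edge from $u$ to $v$, and $d^+_T(v)$, $d^-_T(v)$ are the out- and in-degree of $v$. For an $h$-vertex tournament $H$, an $n$-vertex tournament $T$ and $U\subseteq V(T)$, let $N^*_T(H;U)$ be the number of maps $\phi:V(H)\to U$ such that $\vec{uv}\in E(H)$ if and only if $\overrightarrow{\phi(u)\phi(v)}\in E(T)$. For an ordering (bijection) $\sigma:V(T)\to\{1,\dots,n\}$ let $F_{\sigma,T}$ be the set of edges $\vec{uv}$ of $T$ with $\sigma(u)<\sigma(v)$. The tournament $H$ is called *locally forcing* if for every $\varepsilon>0$ there are $\delta>0$ and $n_0\in\mathbb N$ such that for all $n\ge n_0$ and every $n$-vertex tournament $T$: if $$\bigl|N^*_T(H;U)-2^{-\binom h2}|U|^h\bigr|\le\delta n^h\quad\text{for every }U\subseteq V(T),$$ then $$\Bigl||F_{\sigma,T}|-\tfrac12\tbinom n2\Bigr|\le\varepsilon n^2\quad\text{for every ordering }\sigma\text{ of }T.$$ Let $H$ be the random $h$-vertex tournament on $\{1,\dots,h\}$, obtained by orienting each pair of vertices uniformly at random,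 independently between pairs (equivalently, $H$ is uniformly distributed over all $2^{\binom h2}$ tournaments on $\{1,\dots,h\}$). Then: 1. For every $h\ge 0$ with $h\notin\{3,4\}$, $$\mathbb P\bigl(H\text{ is not locally forcing}\bigr)\ \ge\ \tfrac1{205}.$$ 2. For every $h\ge 3$, $$\mathbb P\Bigl(\sum_{v}\bigl(d^+_H(v)-d^-_H(v)\bigr)^2>h(h-1)\Bigr)\ \ge\ \tfrac1{205}.$$ -/

import Mathlib

open MeasureTheory ProbabilityTheory

/-- A tournament on the vertex set `V`; `T.Adj u v` means that the edge `uv` is directed from `u`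
to `v`. There are no loops, and exactly one of `uv`, `vu` is an edge for distinct `u`, `v`. -/
@[ext]
structure Tournament (V : Type*) where
  Adj : V → V → Prop
  irrefl : ∀ u, ¬ Adj u u
  xor_adj : ∀ u v, u ≠ v → Xor (Adj u v) (Adj v u)

namespace Tournament

/-- A labelled embedding of `H` into `T` (injectivity is automatic). -/
def IsLabelledEmbedding {W V : Type*} (H : Tournament W) (T : Tournament V) (φ : W → V) : Prop :=
  ∀ u v, H.Adj u v ↔ T.Adj (φ u) (φ v)

/-- The number of labelled embeddings of `H` into `T`. -/
noncomputable def embCount {W V : Type*} (H : Tournament W) (T : Tournament V) : ℕ :=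
  {φ : W → V | IsLabelledEmbedding H T φ}.ncard

/-- The subtournament `T[U]` induced by the set `U` of vertices. -/
def induce {V : Type*} (T : Tournament V) (U : Set V) : Tournament U where
  Adj u v := T.Adj u v
  irrefl u := T.irrefl u
  xor_adj u v huv := T.xor_adj u v (Subtype.coe_injective.ne huv)

/-- The out-degree of `u`. -/
noncomputable def outDegree {V : Type*} (T : Tournament V) (u : V) : ℕ :=
  {v | T.Adj u v}.ncard

/-- The in-degree of `u`. -/
noncomputable def inDegree {V : Type*} (T : Tournament V) (u : V) : ℕ :=
  {v | T.Adj v u}.ncard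

/-- The set of forward edges of `T` with respect to the ordering `σ` of the vertices. -/
def forwardEdges {n : ℕ} (T : Tournament (Fin n)) (σ : Fin n ≃ Fin n) : Set (Fin n × Fin n) :=
  {e | T.Adj e.1 e.2 ∧ σ e.1 < σ e.2}

/-- `|F_{σ,T}| = (1/2) * (n choose 2) ± ε n ^ 2` for every ordering `σ` of the `n`-vertex
tournament `T`. -/
def IsQuasirandomWith {n : ℕ} (ε : ℝ) (T : Tournament (Fin n)) : Prop :=
  ∀ σ : Fin n ≃ Fin n,
    |((T.forwardEdges σ).ncard : ℝ) - (1 / 2) * (n.choose 2 : ℝ)| ≤ ε * (n : ℝ) ^ 2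

/-- `N*_T(H;U) = 2 ^ (-(h choose 2)) |U| ^ h ± δ n ^ h` for every set `U` of vertices of the
`n`-vertex tournament `T`, where `H` is an `h`-vertex tournament. -/
def HasLocalCounts {h n : ℕ} (H : Tournament (Fin h)) (δ : ℝ) (T : Tournament (Fin n)) : Prop :=
  ∀ U : Set (Fin n),
    |(embCount H (T.induce U) : ℝ) - (1 / 2 : ℝ) ^ (h.choose 2) * (U.ncard : ℝ) ^ h|
      ≤ δ * (n : ℝ) ^ h

/-- `H` is locally forcing: correct counts of `H` in all vertex subsets force
quasirandomness. -/
def LocallyForcing {h : ℕ} (H : Tournament (Fin h)) : Prop :=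
  ∀ ε : ℝ, 0 < ε → ∃ δ : ℝ, 0 < δ ∧ ∃ n₀ : ℕ, ∀ n : ℕ, n₀ ≤ n →
    ∀ T : Tournament (Fin n), HasLocalCounts H δ T → IsQuasirandomWith ε T

/-- The pairs `i < j` in `Fin n`, that is, the edges of the complete graph. -/
abbrev Pairs (n : ℕ) : Type := {p : Fin n × Fin n // p.1 < p.2}

/-- The tournament in which the pair `i < j` is directed from `i` to `j` exactly when
`ω` is `true` at this pair. -/
def ofOrientation {n : ℕ} (ω : Pairs n → Bool) : Tournament (Fin n) where
  Adj i j := (∃ hij : i < j, ω ⟨(i, j), hij⟩ = true) ∨ (∃ hji : j < i, ω ⟨(j, i), hji⟩ = false)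
  irrefl i := by simp
  xor_adj i j hij := by
    rcases lt_or_gt_of_ne hij with h | h
    · cases hω : ω ⟨(i, j), h⟩ <;> simp [Xor, h, h.not_gt, hω]
    · cases hω : ω ⟨(j, i), h⟩ <;> simp [Xor, h, h.not_gt, hω]

/-- Every set of tournaments is an event. -/
instance (n : ℕ) : MeasurableSpace (Tournament (Fin n)) := ⊤

/-- The law `𝒯(n, α)`: independently for each pair `i < j`, the edge is directed from `i` to `j`
with probability `α`, and from `j` to `i` with probability `1 - α`. -/
noncomputable def randomTournament (n : ℕ) (α : unitInterval) : Measure (Tournament (Fin n)) :=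
  (Measure.pi fun _ : Pairs n => bernoulliMeasure true false α).map ofOrientation

theorem measurable_ofOrientation {n : ℕ} :
    Measurable (ofOrientation : (Pairs n → Bool) → Tournament (Fin n)) :=
  Measurable.of_discrete

instance (n : ℕ) (α : unitInterval) : IsProbabilityMeasure (randomTournament n α) :=
  Measure.isProbabilityMeasure_map measurable_ofOrientation.aemeasurable

end Tournament

/-- The number `1/2` as a probability. -/
noncomputable def probHalf : unitInterval := ⟨1 / 2, by norm_num, by norm_num⟩

/-! Fix `x ∈ (0, 1]` and orient each pair forward with probability `(1 + x) / 2`. A second-moment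
argument gives an outcome close in cut norm to its expected matrix, so the counting lemma yields the
count of `H` in every `U`. Averaging over permutations of `V(H)` shows that this count depends only
on `|U|`: up to lower order it is `2^(-C(h,2)) |U|^h` times the mean over orderings `π` of `∏ (1 + x
* sign)`, the product running over the edges of `H`. Hence `orderSum H x = h!` makes all local
counts correct, while the identity ordering has too many forward edges, so `H` is not locally
forcing (`not_locallyForcing_of_orderSum_eq`).

Such an `x` comes from the intermediate value theorem. At `0` the polynomial `orderSum H` equals
`h!`, its linear coefficient vanishes, and its quadratic coefficient is `h! * (Q - h(h-1)) / 6`,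
where `Q` is the sum of squared score differences. If `Q > h(h-1)`, it exceeds `h!` for small `x`.
If `H` is not transitive, it vanishes at `1`, so it takes the value `h!` in between
(`not_locallyForcing_of_scores`).

For random `H`, `Q - h(h-1)` is a quadratic Rademacher chaos of mean zero with fourth moment at most
`27` times its squared variance. Comparison with a quartic polynomial gives `P(Q > h(h-1)) ≥
22/2401` for `h ≥ 3` (`spread_prob_ge`), which implies the second claim. For `h ≥ 7` transitive
tournaments have probability at most `1/400`, which leaves more than `1/205`. For `h = 5, 6`
explicit families have density `1/128`, and for `h ≤ 2` the polynomial `orderSum H` is constant. -/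

namespace Tournament

open Finset

/-- The sign of the pair `(x, y)` with respect to the order. -/
noncomputable def ordSign {α : Type*} [LinearOrder α] (x y : α) : ℝ :=
  if x < y then 1 else if y < x then -1 else 0

/-! ### Signs of ordered pairs. -/

section ordSign

variable {α : Type*} [LinearOrder α]

theorem ordSign_self (x : α) : ordSign x x = 0 := by simp [ordSign]

theorem ordSign_swap (x y : α) : ordSign y x = -ordSign x y := by
  rcases lt_trichotomy x y with h | h | h <;> simp [ordSign, h, h.not_gt]

theorem ordSign_of_lt {x y : α} (h : x < y) : ordSign x y = 1 := by simp [ordSign, h]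

theorem ordSign_of_gt {x y : α} (h : y < x) : ordSign x y = -1 := by
  simp [ordSign, h, h.not_gt]

theorem ordSign_eq_one_or {x y : α} (h : x ≠ y) : ordSign x y = 1 ∨ ordSign x y = -1 := by
  rcases lt_or_gt_of_ne h with h | h
  · exact Or.inl (ordSign_of_lt h)
  · exact Or.inr (ordSign_of_gt h)

theorem ordSign_sq {x y : α} (h : x ≠ y) : ordSign x y * ordSign x y = 1 := by
  rcases ordSign_eq_one_or h with h | h <;> simp [h]

theorem ordSign_congr {β : Type*} [LinearOrder β] {x y : α} {x' y' : β}
    (h : x < y ↔ x' < y') (h' : y < x ↔ y' < x') : ordSign x y = ordSign x' y' := by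
  simp only [ordSign, h, h']

/-- Among three distinct points the products of signs seen from each point sum to `1`. -/
theorem ordSign_triple {x y z : α} (hxy : x ≠ y) (hxz : x ≠ z) (hyz : y ≠ z) :
    ordSign x y * ordSign x z + ordSign y x * ordSign y z + ordSign z x * ordSign z y = 1 := by
  rcases lt_or_gt_of_ne hxy with h1 | h1 <;> rcases lt_or_gt_of_ne hxz with h2 | h2 <;>
    rcases lt_or_gt_of_ne hyz with h3 | h3 <;>
    first
    | (exfalso; order)
    | (simp [ordSign, h1, h2, h3, h1.not_gt, h2.not_gt, h3.not_gt])

end ordSign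

/-! ### Adjacency and skew-adjacency matrices. -/

section basic

variable {V : Type*}

open scoped Classical in
/-- The adjacency matrix of a tournament. -/
noncomputable def adjMatrix (T : Tournament V) (u v : V) : ℝ := if T.Adj u v then 1 else 0

/-- The skew-symmetric adjacency matrix of a tournament. -/
noncomputable def skew (T : Tournament V) (u v : V) : ℝ := T.adjMatrix u v - T.adjMatrix v u

theorem adjMatrix_nonneg (T : Tournament V) (u v : V) : 0 ≤ T.adjMatrix u v := by
  unfold adjMatrix; split_ifs <;> simp

theorem adjMatrix_le_one (T : Tournament V) (u v : V) : T.adjMatrix u v ≤ 1 := by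
  unfold adjMatrix; split_ifs <;> simp

theorem not_adj_of_adj (T : Tournament V) {u v : V} (h : T.Adj u v) : ¬ T.Adj v u := by
  intro h'
  have huv : u ≠ v := by rintro rfl; exact T.irrefl u h
  rcases T.xor_adj u v huv with h1 | h1
  · exact h1.2 h'
  · exact h1.2 h

theorem adj_of_not_adj (T : Tournament V) {u v : V} (huv : u ≠ v) (h : ¬ T.Adj u v) :
    T.Adj v u := by
  rcases T.xor_adj u v huv with h1 | h1
  · exact absurd h1.1 h
  · exact h1.1

theorem adjMatrix_self (T : Tournament V) (u : V) : T.adjMatrix u u = 0 := by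
  simp [adjMatrix, T.irrefl]

theorem adjMatrix_add_swap (T : Tournament V) {u v : V} (h : u ≠ v) :
    T.adjMatrix u v + T.adjMatrix v u = 1 := by
  by_cases h1 : T.Adj u v
  · simp [adjMatrix, h1, T.not_adj_of_adj h1]
  · simp [adjMatrix, h1, T.adj_of_not_adj h h1]

theorem skew_swap (T : Tournament V) (u v : V) : T.skew v u = -T.skew u v := by
  simp [skew]

theorem skew_self (T : Tournament V) (u : V) : T.skew u u = 0 := by simp [skew]

theorem skew_mul_self (T : Tournament V) {u v : V} (h : u ≠ v) : T.skew u v * T.skew u v = 1 := by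
  by_cases h1 : T.Adj u v
  · simp [skew, adjMatrix, h1, T.not_adj_of_adj h1]
  · simp [skew, adjMatrix, h1, T.adj_of_not_adj h h1]

theorem sum_skew (V : Type*) [Fintype V] (T : Tournament V) (u : V) :
    ∑ v, T.skew u v = (T.outDegree u : ℝ) - (T.inDegree u : ℝ) := by
  classical
  simp only [skew, adjMatrix, sum_sub_distrib, sum_boole, outDegree, inDegree]
  simp [Set.ncard_eq_toFinset_card']

variable [Fintype V]

open scoped Classical in
/-- The set of edges of a finite tournament. -/
noncomputable def edges (H : Tournament V) : Finset (V × V) :=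
  univ.filter fun e => H.Adj e.1 e.2

theorem mem_edges {H : Tournament V} {e : V × V} : e ∈ H.edges ↔ H.Adj e.1 e.2 := by
  simp [edges]

theorem ne_of_mem_edges {H : Tournament V} {e : V × V} (he : e ∈ H.edges) : e.1 ≠ e.2 := by
  intro h
  have := mem_edges.1 he
  rw [h] at this
  exact H.irrefl _ this

theorem sum_edges (H : Tournament V) (g : V → V → ℝ) :
    ∑ e ∈ H.edges, g e.1 e.2 = ∑ u, ∑ v, H.adjMatrix u v * g u v := by
  classical
  rw [← sum_product', edges, sum_filter]
  refine sum_congr rfl fun e _ => ?_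
  simp [adjMatrix]

theorem sum_edges_skew (H : Tournament V) (g : V → V → ℝ) (hg : ∀ u v, g v u = -g u v) :
    2 * ∑ e ∈ H.edges, g e.1 e.2 = ∑ u, ∑ v, H.skew u v * g u v := by
  have h2 : ∑ u, ∑ v, H.adjMatrix v u * g u v = -∑ u, ∑ v, H.adjMatrix u v * g u v := by
    rw [sum_comm, ← sum_neg_distrib]
    refine sum_congr rfl fun u _ => ?_
    rw [← sum_neg_distrib]
    refine sum_congr rfl fun v _ => ?_
    rw [hg u v]; ring
  rw [sum_edges]
  simp only [skew, sub_mul, sum_sub_distrib, h2]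
  ring

theorem sum_ne_one [DecidableEq V] :
    ∑ u : V, ∑ v : V, (if u ≠ v then (1 : ℝ) else 0) =
      (Fintype.card V : ℝ) * (Fintype.card V - 1) := by
  have : ∀ u v : V, (if u ≠ v then (1 : ℝ) else 0) = 1 - if u = v then 1 else 0 := by
    intro u v; split_ifs <;> simp_all
  simp [this, sum_sub_distrib]
  ring

theorem card_edges (H : Tournament V) : #H.edges = (Fintype.card V).choose 2 := by
  classical
  have h1 : (#H.edges : ℝ) = ∑ u, ∑ v, H.adjMatrix u v := by
    simpa using H.sum_edges fun _ _ => 1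
  have h2 : (2 : ℝ) * #H.edges = (Fintype.card V : ℝ) * (Fintype.card V - 1) := by
    rw [two_mul]
    nth_rw 2 [h1]
    rw [sum_comm, h1, ← sum_ne_one, ← sum_add_distrib]
    refine sum_congr rfl fun u _ => ?_
    rw [← sum_add_distrib]
    refine sum_congr rfl fun v _ => ?_
    by_cases h : u = v
    · simp [h, adjMatrix_self]
    · simp [h, adjMatrix_add_swap]
  have h3 : (((Fintype.card V).choose 2 : ℕ) : ℝ) = (Fintype.card V : ℝ) * (Fintype.card V - 1) / 2 :=
    Nat.cast_choose_two ℝ _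
  have : (#H.edges : ℝ) = (((Fintype.card V).choose 2 : ℕ) : ℝ) := by linarith
  exact_mod_cast this

end basic

/-! ### Uniform random tournaments as counts of orientations. -/

theorem ofOrientation_adj_of_lt {n : ℕ} (ω : Pairs n → Bool) {i j : Fin n} (h : i < j) :
    (ofOrientation ω).Adj i j ↔ ω ⟨(i, j), h⟩ = true := by
  simp [ofOrientation, h, h.not_gt]

theorem ofOrientation_adj_of_gt {n : ℕ} (ω : Pairs n → Bool) {i j : Fin n} (h : j < i) :
    (ofOrientation ω).Adj i j ↔ ω ⟨(j, i), h⟩ = false := by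
  simp [ofOrientation, h, h.not_gt]

theorem card_pairs (n : ℕ) : Fintype.card (Pairs n) = n.choose 2 := by
  have := (ofOrientation (n := n) fun _ => true).card_edges
  rw [Fintype.card_fin] at this
  rw [← this, Fintype.card_subtype]
  congr 1
  ext e
  simp [mem_edges, ofOrientation]

theorem randomTournament_half_real {n : ℕ} (S : Set (Tournament (Fin n)))
    [DecidablePred fun ω : Pairs n → Bool => ofOrientation ω ∈ S] :
    (randomTournament n probHalf).real S =
      (#{ω : Pairs n → Bool | ofOrientation ω ∈ S} : ℝ) / 2 ^ n.choose 2 := by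
  have hb : ∀ b : Bool, (bernoulliMeasure true false probHalf) {b} = (2⁻¹ : ENNReal) := by
    intro b
    have h1 : ((unitInterval.toNNReal probHalf : NNReal) : ENNReal) = 2⁻¹ := by
      have : unitInterval.toNNReal probHalf = 2⁻¹ := by
        ext; simp [probHalf, unitInterval.toNNReal]; rfl
      rw [this]; simp
    have h2 : ((unitInterval.toNNReal (unitInterval.symm probHalf) : NNReal) : ENNReal) = 2⁻¹ := by
      have : unitInterval.toNNReal (unitInterval.symm probHalf) = 2⁻¹ := by
        ext; simp [probHalf, unitInterval.toNNReal]; norm_num; rfl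
      rw [this]; simp
    rw [bernoulliMeasure_apply _ (measurableSet_singleton b)]
    cases b <;> simp [h1, h2]
  rw [randomTournament, map_measureReal_apply measurable_ofOrientation trivial]
  have hs : (ofOrientation ⁻¹' S : Set (Pairs n → Bool)) =
      ((univ.filter fun ω : Pairs n → Bool => ofOrientation ω ∈ S : Finset _) : Set _) := by
    ext; simp
  rw [hs, measureReal_def, ← sum_measure_singleton]
  simp only [Measure.pi_singleton, hb, prod_const, card_univ, card_pairs, sum_const, nsmul_eq_mul]
  simp [ENNReal.toReal_mul, div_eq_mul_inv]

end Tournament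

/-! ### The counting lemma and the cut norm. -/

namespace Tournament

open Finset

section counting

variable {ι V : Type*} [Fintype ι] [DecidableEq ι] [Fintype V]

theorem sum_sum_update (G : (ι → V) → ℝ) (i : ι) :
    ∑ φ, ∑ x, G (Function.update φ i x) = (Fintype.card V : ℝ) * ∑ φ, G φ := by
  have h : ∑ p : (ι → V) × V, G (Function.update p.1 i p.2) = ∑ p : (ι → V) × V, G p.1 := by
    refine sum_bij' (fun p _ => (Function.update p.1 i p.2, p.1 i))
      (fun p _ => (Function.update p.1 i p.2, p.1 i)) ?_ ?_ ?_ ?_ ?_ <;> simp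
  rw [Fintype.sum_prod_type, Fintype.sum_prod_type] at h
  rw [h]
  simp [mul_sum]

/-- A function of which every two-coordinate section has a small sum has a small sum. -/
theorem abs_sum_le_of_section {G : (ι → V) → ℝ} {K : ℝ} (i j : ι)
    (hG : ∀ φ, |∑ x, ∑ y, G (Function.update (Function.update φ i x) j y)| ≤ K) :
    |∑ φ, G φ| * (Fintype.card V : ℝ) ^ 2 ≤ K * (Fintype.card V : ℝ) ^ Fintype.card ι := by
  have h1 : ∑ φ : ι → V, ∑ x, ∑ y, G (Function.update (Function.update φ i x) j y) =
      (Fintype.card V : ℝ) ^ 2 * ∑ φ, G φ := by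
    rw [sum_sum_update (fun φ => ∑ y, G (Function.update φ j y)) i, sum_sum_update]
    ring
  have h2 : |∑ φ, G φ| * (Fintype.card V : ℝ) ^ 2 =
      |∑ φ : ι → V, ∑ x, ∑ y, G (Function.update (Function.update φ i x) j y)| := by
    rw [h1, abs_mul, abs_of_nonneg (by positivity : (0 : ℝ) ≤ (Fintype.card V : ℝ) ^ 2), mul_comm]
  rw [h2]
  refine (abs_sum_le_sum_abs _ _).trans ((sum_le_sum fun φ _ => hG φ).trans ?_)
  simp [mul_comm]

/-- Replacing the matrix attached to one edge changes a weighted homomorphism sum by at most the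
cut norm of the difference. -/
theorem abs_sum_edge_le {f : V → V → ℝ} {K : ℝ}
    (hf : ∀ a b : V → ℝ, (∀ x, 0 ≤ a x ∧ a x ≤ 1) → (∀ x, 0 ≤ b x ∧ b x ≤ 1) →
      |∑ x, ∑ y, a x * b y * f x y| ≤ K)
    (u : V → ℝ) (hu : ∀ x, 0 ≤ u x ∧ u x ≤ 1)
    (R : Finset (ι × ι)) (M : ι × ι → V → V → ℝ) (hM : ∀ e x y, 0 ≤ M e x y ∧ M e x y ≤ 1)
    {i j : ι} (hij : i ≠ j) (hR : ∀ e ∈ R, e ≠ (i, j) ∧ e ≠ (j, i) ∧ e.1 ≠ e.2) :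
    |∑ φ : ι → V, (∏ k, u (φ k)) * (f (φ i) (φ j) * ∏ e ∈ R, M e (φ e.1) (φ e.2))| *
      (Fintype.card V : ℝ) ^ 2 ≤ K * (Fintype.card V : ℝ) ^ Fintype.card ι := by
  apply abs_sum_le_of_section i j
  intro φ
  set ψ : V → V → ι → V := fun x y => Function.update (Function.update φ i x) j y with hψ
  have hψi : ∀ x y, ψ x y i = x := by intro x y; simp [hψ, hij]
  have hψj : ∀ x y, ψ x y j = y := by intro x y; simp [hψ]
  have hψk : ∀ x y k, k ≠ i → k ≠ j → ψ x y k = φ k := by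
    intro x y k h1 h2; simp [hψ, h1, h2]
  -- With all vertices except `i` and `j` fixed, an edge meeting `i` avoids `j`, because `{i, j}` is
  -- not in `R`; its factor depends on `x` alone. Every other factor depends on `y` alone. Thus the
  -- section is a bilinear form `∑ a x * b y * f x y`.
  let Ri := R.filter fun e => e.1 = i ∨ e.2 = i
  let Rj := R.filter fun e => ¬ (e.1 = i ∨ e.2 = i)
  have hprod : ∀ x y, ∏ e ∈ R, M e (ψ x y e.1) (ψ x y e.2) =
      (∏ e ∈ Ri, M e (ψ x x e.1) (ψ x x e.2)) * ∏ e ∈ Rj, M e (ψ y y e.1) (ψ y y e.2) := by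
    intro x y
    rw [← prod_filter_mul_prod_filter_not R (fun e => e.1 = i ∨ e.2 = i)]
    congr 1
    · refine prod_congr rfl fun e he => ?_
      obtain ⟨he, h⟩ := mem_filter.1 he
      obtain ⟨h1, h2, h3⟩ := hR e he
      rcases h with h | h
      · have h4 : e.2 ≠ i := fun h' => h3 (h.trans h'.symm)
        have h5 : e.2 ≠ j := fun h' => h1 (Prod.ext h h')
        rw [h, hψi, hψi, hψk _ _ _ h4 h5, hψk _ _ _ h4 h5]
      · have h4 : e.1 ≠ i := fun h' => h3 (h'.trans h.symm)
        have h5 : e.1 ≠ j := fun h' => h2 (Prod.ext h' h)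
        rw [h, hψi, hψi, hψk _ _ _ h4 h5, hψk _ _ _ h4 h5]
    · refine prod_congr rfl fun e he => ?_
      obtain ⟨he, h⟩ := mem_filter.1 he
      push Not at h
      have key : ∀ k, k ≠ i → ψ x y k = ψ y y k := by
        intro k hk
        by_cases hkj : k = j
        · rw [hkj, hψj, hψj]
        · rw [hψk _ _ _ hk hkj, hψk _ _ _ hk hkj]
      rw [key _ h.1, key _ h.2]
  have huprod : ∀ x y, ∏ k, u (ψ x y k) =
      u x * (u y * ∏ k ∈ (univ.erase i).erase j, u (φ k)) := by
    intro x y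
    rw [← mul_prod_erase univ _ (mem_univ i),
      ← mul_prod_erase (univ.erase i) _ (mem_erase.2 ⟨hij.symm, mem_univ j⟩), hψi, hψj]
    congr 2
    refine prod_congr rfl fun k hk => ?_
    rw [hψk]
    · exact (mem_erase.1 (mem_erase.1 hk).2).1
    · exact (mem_erase.1 hk).1
  have hp : ∀ (s : Finset (ι × ι)) (g : ι → V),
      0 ≤ ∏ e ∈ s, M e (g e.1) (g e.2) ∧ ∏ e ∈ s, M e (g e.1) (g e.2) ≤ 1 := fun s g =>
    ⟨prod_nonneg fun e _ => (hM _ _ _).1,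
      prod_le_one (fun e _ => (hM _ _ _).1) fun e _ => (hM _ _ _).2⟩
  have hc : 0 ≤ ∏ k ∈ (univ.erase i).erase j, u (φ k) ∧
      ∏ k ∈ (univ.erase i).erase j, u (φ k) ≤ 1 :=
    ⟨prod_nonneg fun k _ => (hu _).1, prod_le_one (fun k _ => (hu _).1) fun k _ => (hu _).2⟩
  have := hf (fun x => u x * ∏ e ∈ Ri, M e (ψ x x e.1) (ψ x x e.2))
    (fun y => u y * (∏ k ∈ (univ.erase i).erase j, u (φ k)) *
      ∏ e ∈ Rj, M e (ψ y y e.1) (ψ y y e.2))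
    (fun x => ⟨mul_nonneg (hu x).1 (hp _ _).1, mul_le_one₀ (hu x).2 (hp _ _).1 (hp _ _).2⟩)
    (fun y => ⟨mul_nonneg (mul_nonneg (hu y).1 hc.1) (hp _ _).1,
      mul_le_one₀ (mul_le_one₀ (hu y).2 hc.1 hc.2) (hp _ _).1 (hp _ _).2⟩)
  refine le_of_eq_of_le ?_ this
  congr 1
  refine sum_congr rfl fun x _ => sum_congr rfl fun y _ => ?_
  change (∏ k, u (ψ x y k)) * (f (ψ x y i) (ψ x y j) * ∏ e ∈ R, M e (ψ x y e.1) (ψ x y e.2)) = _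
  rw [hprod, huprod, hψi, hψj]
  ring

/-- The counting lemma: matrices that are close in cut norm have close weighted homomorphism
sums. -/
theorem counting_lemma {A B : V → V → ℝ} {K : ℝ}
    (hA : ∀ x y, 0 ≤ A x y ∧ A x y ≤ 1) (hB : ∀ x y, 0 ≤ B x y ∧ B x y ≤ 1)
    (hK : ∀ a b : V → ℝ, (∀ x, 0 ≤ a x ∧ a x ≤ 1) → (∀ x, 0 ≤ b x ∧ b x ≤ 1) →
      |∑ x, ∑ y, a x * b y * (A x y - B x y)| ≤ K)
    (u : V → ℝ) (hu : ∀ x, 0 ≤ u x ∧ u x ≤ 1)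
    (E : Finset (ι × ι)) (hE : ∀ e ∈ E, e.1 ≠ e.2 ∧ e.swap ∉ E) :
    |∑ φ : ι → V, (∏ k, u (φ k)) * (∏ e ∈ E, A (φ e.1) (φ e.2)) -
      ∑ φ : ι → V, (∏ k, u (φ k)) * ∏ e ∈ E, B (φ e.1) (φ e.2)| * (Fintype.card V : ℝ) ^ 2 ≤
      #E * (K * (Fintype.card V : ℝ) ^ Fintype.card ι) := by
  set F : (ι × ι → V → V → ℝ) → ℝ := fun M =>
    ∑ φ : ι → V, (∏ k, u (φ k)) * ∏ e ∈ E, M e (φ e.1) (φ e.2) with hF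
  set AA : ι × ι → V → V → ℝ := fun _ => A
  set BB : ι × ι → V → V → ℝ := fun _ => B
  -- Telescoping: `S` is the set of edges that already carry `A`, and each replacement costs at most
  -- one cut-norm term.
  have main : ∀ S ⊆ E, |F (S.piecewise AA BB) - F BB| * (Fintype.card V : ℝ) ^ 2 ≤
      #S * (K * (Fintype.card V : ℝ) ^ Fintype.card ι) := by
    intro S
    induction S using Finset.induction_on with
    | empty => intro _; simp
    | insert e S heS ih =>
      intro hS
      have heE : e ∈ E := hS (mem_insert_self _ _)
      have ih := ih ((subset_insert _ _).trans hS)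
      have hstep : F ((insert e S).piecewise AA BB) - F (S.piecewise AA BB) =
          ∑ φ : ι → V, (∏ k, u (φ k)) * ((fun x y => A x y - B x y) (φ e.1) (φ e.2) *
            ∏ e' ∈ E.erase e, (S.piecewise AA BB) e' (φ e'.1) (φ e'.2)) := by
        simp only [hF]
        rw [← sum_sub_distrib]
        refine sum_congr rfl fun φ _ => ?_
        rw [← mul_prod_erase E _ heE, ← mul_prod_erase E (fun e' =>
          (S.piecewise AA BB) e' (φ e'.1) (φ e'.2)) heE]
        have h1 : ∏ e' ∈ E.erase e, ((insert e S).piecewise AA BB) e' (φ e'.1) (φ e'.2) =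
            ∏ e' ∈ E.erase e, (S.piecewise AA BB) e' (φ e'.1) (φ e'.2) := by
          refine prod_congr rfl fun e' he' => ?_
          simp [Finset.piecewise, (mem_erase.1 he').1]
        rw [h1, piecewise_insert_self, piecewise_eq_of_notMem _ _ _ heS]
        simp only [AA, BB]
        ring
      have hb := abs_sum_edge_le (ι := ι) hK u hu (E.erase e) (S.piecewise AA BB)
        (by
          intro e' x y
          by_cases h : e' ∈ S
          · rw [piecewise_eq_of_mem _ _ _ h]; exact hA x y
          · rw [piecewise_eq_of_notMem _ _ _ h]; exact hB x y)
        (hE e heE).1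
        (by
          intro e' he'
          refine ⟨(mem_erase.1 he').1, ?_, (hE e' (mem_erase.1 he').2).1⟩
          rintro rfl
          exact (hE e heE).2 (mem_erase.1 he').2)
      rw [← hstep] at hb
      rw [card_insert_of_notMem heS]
      have h3 : |F ((insert e S).piecewise AA BB) - F BB| ≤
          |F ((insert e S).piecewise AA BB) - F (S.piecewise AA BB)| +
            |F (S.piecewise AA BB) - F BB| := abs_sub_le _ _ _
      push_cast
      nlinarith [sq_nonneg (Fintype.card V : ℝ)]
  have := main E Subset.rfl
  have h1 : F (E.piecewise AA BB) =
      ∑ φ : ι → V, (∏ k, u (φ k)) * (∏ e ∈ E, A (φ e.1) (φ e.2)) := by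
    simp only [hF]
    refine sum_congr rfl fun φ _ => ?_
    congr 1
    refine prod_congr rfl fun e he => ?_
    rw [piecewise_eq_of_mem _ _ _ he]
  rw [h1] at this
  exact this

end counting

/-- The cut norm of a matrix is controlled by its codegrees. -/
theorem abs_bilinear_pow_le {V : Type*} [Fintype V] (f : V → V → ℝ) (a b : V → ℝ)
    (ha : ∀ x, 0 ≤ a x ∧ a x ≤ 1) (hb : ∀ x, 0 ≤ b x ∧ b x ≤ 1) :
    |∑ x, ∑ y, a x * b y * f x y| ^ 4 ≤
      (Fintype.card V : ℝ) ^ 4 * ∑ y, ∑ y', (∑ x, f x y * f x y') ^ 2 := by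
  set n : ℝ := (Fintype.card V : ℝ) with hn
  have hn0 : 0 ≤ n := by positivity
  -- Cauchy–Schwarz twice: first to remove `a`, then, after expanding the square into codegrees, to
  -- remove `b`.
  have h1 : (∑ x, ∑ y, a x * b y * f x y) ^ 2 ≤ n * ∑ x, (∑ y, b y * f x y) ^ 2 := by
    have e1 : ∑ x, ∑ y, a x * b y * f x y = ∑ x, a x * ∑ y, b y * f x y := by
      simp only [mul_sum, mul_assoc]
    rw [e1]
    refine (sum_mul_sq_le_sq_mul_sq _ _ _).trans ?_
    refine mul_le_mul_of_nonneg_right ?_ (sum_nonneg fun _ _ => sq_nonneg _)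
    calc ∑ x, a x ^ 2 ≤ ∑ _x : V, (1 : ℝ) :=
          sum_le_sum fun x _ => pow_le_one₀ (ha x).1 (ha x).2
      _ = n := by simp [hn]
  have h2 : ∑ x, (∑ y, b y * f x y) ^ 2 = ∑ p : V × V, b p.1 * b p.2 * ∑ x, f x p.1 * f x p.2 := by
    rw [Fintype.sum_prod_type]
    simp only [sq, sum_mul_sum]
    rw [sum_comm]
    refine sum_congr rfl fun y _ => ?_
    rw [sum_comm]
    refine sum_congr rfl fun y' _ => ?_
    rw [mul_sum]
    refine sum_congr rfl fun x _ => ?_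
    ring
  have h3 : (∑ x, (∑ y, b y * f x y) ^ 2) ^ 2 ≤ n ^ 2 * ∑ y, ∑ y', (∑ x, f x y * f x y') ^ 2 := by
    rw [h2]
    refine (sum_mul_sq_le_sq_mul_sq _ _ _).trans ?_
    rw [Fintype.sum_prod_type (fun p : V × V => (∑ x, f x p.1 * f x p.2) ^ 2)]
    refine mul_le_mul_of_nonneg_right ?_
      (sum_nonneg fun _ _ => sum_nonneg fun _ _ => sq_nonneg _)
    calc ∑ p : V × V, (b p.1 * b p.2) ^ 2 ≤ ∑ _p : V × V, (1 : ℝ) := by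
          refine sum_le_sum fun p _ => pow_le_one₀ (mul_nonneg (hb _).1 (hb _).1) ?_
          exact mul_le_one₀ (hb _).2 (hb _).1 (hb _).2
      _ = n ^ 2 := by simp [hn, sq]
  have h4 : 0 ≤ ∑ x, (∑ y, b y * f x y) ^ 2 := sum_nonneg fun _ _ => sq_nonneg _
  calc |∑ x, ∑ y, a x * b y * f x y| ^ 4 = ((∑ x, ∑ y, a x * b y * f x y) ^ 2) ^ 2 := by
        rw [← sq_abs (∑ x, ∑ y, a x * b y * f x y)]; ring
    _ ≤ (n * ∑ x, (∑ y, b y * f x y) ^ 2) ^ 2 := pow_le_pow_left₀ (sq_nonneg _) h1 2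
    _ = n ^ 2 * (∑ x, (∑ y, b y * f x y) ^ 2) ^ 2 := by ring
    _ ≤ n ^ 2 * (n ^ 2 * ∑ y, ∑ y', (∑ x, f x y * f x y') ^ 2) :=
        mul_le_mul_of_nonneg_left h3 (sq_nonneg _)
    _ = _ := by ring

end Tournament

/-! ### Counts of `H` in subsets and in the biased matrix. -/

namespace Tournament

open Finset

/-- The expected adjacency matrix of the random tournament in which forward edges have
probability `(1 + x) / 2`. -/
noncomputable def biasedMatrix {n : ℕ} (x : ℝ) (u v : Fin n) : ℝ :=
  if u = v then 0 else (1 + x * ordSign u v) / 2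

/-- The sum over all orderings of the vertices of `H` of the normalised probability that a biased
random tournament is a copy of `H` in this ordering. -/
noncomputable def orderSum {h : ℕ} (H : Tournament (Fin h)) (x : ℝ) : ℝ :=
  ∑ π : Equiv.Perm (Fin h), ∏ e ∈ H.edges, (1 + x * ordSign (π e.1) (π e.2))

open scoped Classical in
/-- The real-valued indicator function of a set. -/
noncomputable def setIndicator {V : Type*} (U : Set V) (v : V) : ℝ := if v ∈ U then 1 else 0

theorem setIndicator_mem {V : Type*} (U : Set V) (v : V) :
    0 ≤ setIndicator U v ∧ setIndicator U v ≤ 1 := by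
  unfold setIndicator; split_ifs <;> simp

theorem biasedMatrix_mem {n : ℕ} {x : ℝ} (hx0 : 0 ≤ x) (hx1 : x ≤ 1) (u v : Fin n) :
    0 ≤ biasedMatrix x u v ∧ biasedMatrix x u v ≤ 1 := by
  unfold biasedMatrix ordSign
  split_ifs <;> constructor <;> linarith

/-- Preserving edges suffices for an embedding: if `uv` is not an edge of `H` and `u ≠ v`, then `vu`
is one, and its image excludes the reverse edge in `T`. -/
theorem embCount_eq_sum {h n : ℕ} (H : Tournament (Fin h)) (T : Tournament (Fin n))
    (U : Set (Fin n)) :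
    (embCount H (T.induce U) : ℝ) = ∑ φ : Fin h → Fin n,
      (∏ k, setIndicator U (φ k)) * ∏ e ∈ H.edges, T.adjMatrix (φ e.1) (φ e.2) := by
  classical
  have hinj : Function.Injective (fun (φ : Fin h → U) (k : Fin h) => (φ k : Fin n)) := by
    intro φ ψ hφ
    funext k
    exact Subtype.ext (congrFun hφ k)
  have h1 : (fun (φ : Fin h → U) (k : Fin h) => (φ k : Fin n)) ''
      {φ | IsLabelledEmbedding H (T.induce U) φ} =
      ((univ.filter fun φ : Fin h → Fin n => (∀ k ∈ (univ : Finset (Fin h)), φ k ∈ U) ∧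
        ∀ e ∈ H.edges, T.Adj (φ e.1) (φ e.2) : Finset _) : Set (Fin h → Fin n)) := by
    ext φ
    simp only [Set.mem_image, Set.mem_ofPred_eq, coe_filter, mem_univ, true_and, forall_const]
    constructor
    · rintro ⟨ψ, hψ, rfl⟩
      exact ⟨fun k => (ψ k).2, fun e he => (hψ _ _).1 (mem_edges.1 he)⟩
    · rintro ⟨hU, hE⟩
      refine ⟨fun k => ⟨φ k, hU k⟩, ?_, rfl⟩
      intro u v
      refine ⟨fun huv => hE (u, v) (mem_edges.2 huv), fun huv => ?_⟩
      by_contra hn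
      have huv' : u ≠ v := by
        rintro rfl
        exact T.irrefl _ huv
      exact T.not_adj_of_adj huv (hE (v, u) (mem_edges.2 (H.adj_of_not_adj huv' hn)))
  rw [embCount, ← Set.ncard_image_of_injective _ hinj, h1, Set.ncard_coe_finset, card_filter]
  push_cast
  refine sum_congr rfl fun φ _ => ?_
  simp only [setIndicator, adjMatrix, prod_boole, ite_and]
  split_ifs <;> simp

theorem sum_injective_indicator {h n : ℕ} (U : Set (Fin n)) :
    (∑ φ : Fin h → Fin n, (∏ k, setIndicator U (φ k)) *
      open scoped Classical in (if Function.Injective φ then (1 : ℝ) else 0)) =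
      (U.ncard.descFactorial h : ℕ) := by
  classical
  have h1 : ∀ φ : Fin h → Fin n, ((∏ k, setIndicator U (φ k)) *
      (if Function.Injective φ then (1 : ℝ) else 0)) =
      if (∀ k, φ k ∈ U) ∧ Function.Injective φ then 1 else 0 := by
    intro φ
    simp only [setIndicator, prod_boole, ite_and, mem_univ, forall_const]
    split_ifs <;> simp
  simp only [h1, sum_boole]
  have h2 : Fintype.card (Fin h ↪ U) = U.ncard.descFactorial h := by
    rw [Fintype.card_embedding_eq, Fintype.card_fin, Set.ncard_eq_toFinset_card',
      Set.toFinset_card]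
  rw [← h2, ← Fintype.card_subtype]
  congr 1
  refine Fintype.card_congr
    { toFun := fun φ => ⟨fun k => ⟨φ.1 k, φ.2.1 k⟩, fun a b hab => φ.2.2 (Subtype.ext_iff.1 hab)⟩
      invFun := fun φ => ⟨fun k => φ k, fun k => (φ k).2,
        fun a b hab => φ.injective (Subtype.ext hab)⟩
      left_inv := fun φ => rfl
      right_inv := fun φ => rfl }

theorem exists_perm_lt_iff {h n : ℕ} {φ : Fin h → Fin n} (hφ : Function.Injective φ) :
    ∃ τ : Equiv.Perm (Fin h), ∀ u v, φ u < φ v ↔ τ u < τ v := by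
  refine ⟨(Tuple.sort φ)⁻¹, fun u v => ?_⟩
  have hs : StrictMono (φ ∘ Tuple.sort φ) :=
    (Tuple.monotone_sort φ).strictMono_of_injective (hφ.comp (Tuple.sort φ).injective)
  have := hs.lt_iff_lt (a := (Tuple.sort φ)⁻¹ u) (b := (Tuple.sort φ)⁻¹ v)
  simpa using this

theorem prod_biasedMatrix_of_injective {h n : ℕ} (H : Tournament (Fin h)) (x : ℝ)
    {φ : Fin h → Fin n} (hφ : Function.Injective φ) :
    ∏ e ∈ H.edges, biasedMatrix x (φ e.1) (φ e.2) =
      (1 / 2) ^ h.choose 2 * ∏ e ∈ H.edges, (1 + x * ordSign (φ e.1) (φ e.2)) := by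
  have hc : (1 / 2 : ℝ) ^ h.choose 2 = ∏ _e ∈ H.edges, (1 / 2 : ℝ) := by
    rw [prod_const, card_edges, Fintype.card_fin]
  rw [hc, ← prod_mul_distrib]
  refine prod_congr rfl fun e he => ?_
  rw [biasedMatrix, if_neg (hφ.ne (ne_of_mem_edges he))]
  ring

/-- Two identified vertices are joined by an edge of `H` in some direction, and this edge meets the
zero diagonal. -/
theorem prod_biasedMatrix_of_not_injective {h n : ℕ} (H : Tournament (Fin h)) (x : ℝ)
    {φ : Fin h → Fin n} (hφ : ¬ Function.Injective φ) :
    ∏ e ∈ H.edges, biasedMatrix x (φ e.1) (φ e.2) = 0 := by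
  simp only [Function.Injective, not_forall] at hφ
  obtain ⟨u, v, huv, hne⟩ := hφ
  by_cases hadj : H.Adj u v
  · exact prod_eq_zero (i := (u, v)) (mem_edges.2 hadj) (by simp [biasedMatrix, huv])
  · exact prod_eq_zero (i := (v, u)) (mem_edges.2 (H.adj_of_not_adj hne hadj))
      (by simp [biasedMatrix, huv])

theorem sum_perm_prod_ordSign {h n : ℕ} (H : Tournament (Fin h)) (x : ℝ)
    {φ : Fin h → Fin n} (hφ : Function.Injective φ) :
    ∑ π : Equiv.Perm (Fin h), ∏ e ∈ H.edges, (1 + x * ordSign (φ (π e.1)) (φ (π e.2))) =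
      H.orderSum x := by
  obtain ⟨τ, hτ⟩ := exists_perm_lt_iff hφ
  rw [orderSum, ← Equiv.sum_comp (Equiv.mulLeft τ) fun π : Equiv.Perm (Fin h) =>
    ∏ e ∈ H.edges, (1 + x * ordSign (π e.1) (π e.2))]
  refine sum_congr rfl fun π _ => prod_congr rfl fun e _ => ?_
  rw [ordSign_congr (hτ _ _) (hτ _ _)]
  rfl

/-- Precomposing `φ` with permutations keeps the indicator weight and runs through every ordering of
the image once. So every injective `φ` into `U` contributes the same amount, and the position of `U`
in the order is irrelevant. -/
theorem sum_biasedMatrix {h n : ℕ} (H : Tournament (Fin h)) (x : ℝ) (U : Set (Fin n)) :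
    (h.factorial : ℝ) * ∑ φ : Fin h → Fin n,
      (∏ k, setIndicator U (φ k)) * ∏ e ∈ H.edges, biasedMatrix x (φ e.1) (φ e.2) =
      (U.ncard.descFactorial h : ℕ) * (1 / 2) ^ h.choose 2 * H.orderSum x := by
  classical
  set W : (Fin h → Fin n) → ℝ := fun φ =>
    (∏ k, setIndicator U (φ k)) * ∏ e ∈ H.edges, biasedMatrix x (φ e.1) (φ e.2) with hW
  have h1 : ∀ π : Equiv.Perm (Fin h), ∑ φ : Fin h → Fin n, W (φ ∘ π) = ∑ φ, W φ := by
    intro π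
    exact Equiv.sum_comp (π.symm.arrowCongr (Equiv.refl (Fin n))) W
  have h2 : (h.factorial : ℝ) * ∑ φ, W φ = ∑ φ : Fin h → Fin n, ∑ π : Equiv.Perm (Fin h),
      W (φ ∘ π) := by
    rw [sum_comm]
    simp [h1, Fintype.card_perm]
  have h3 : ∀ φ : Fin h → Fin n, ∑ π : Equiv.Perm (Fin h), W (φ ∘ π) =
      ((∏ k, setIndicator U (φ k)) * (if Function.Injective φ then (1 : ℝ) else 0)) *
        ((1 / 2) ^ h.choose 2 * H.orderSum x) := by
    intro φ
    have hu : ∀ π : Equiv.Perm (Fin h), ∏ k, setIndicator U (φ (π k)) =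
        ∏ k, setIndicator U (φ k) := fun π =>
      Equiv.prod_comp π fun k => setIndicator U (φ k)
    simp only [hW, Function.comp_apply, hu]
    by_cases hφ : Function.Injective φ
    · have hp : ∀ π : Equiv.Perm (Fin h), ∏ e ∈ H.edges, biasedMatrix x (φ (π e.1)) (φ (π e.2)) =
          (1 / 2) ^ h.choose 2 * ∏ e ∈ H.edges, (1 + x * ordSign (φ (π e.1)) (φ (π e.2))) :=
        fun π => H.prod_biasedMatrix_of_injective x (hφ.comp π.injective)
      simp only [hp, ← mul_sum, sum_perm_prod_ordSign H x hφ, if_pos hφ, mul_one]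
    · have hp : ∀ π : Equiv.Perm (Fin h),
          ∏ e ∈ H.edges, biasedMatrix x (φ (π e.1)) (φ (π e.2)) = 0 := fun π =>
        H.prod_biasedMatrix_of_not_injective x (φ := φ ∘ π)
          (by rwa [π.injective_comp])
      simp [hp, hφ]
  rw [h2]
  simp only [h3]
  rw [← sum_mul, sum_injective_indicator]
  ring

/-- Non-injective maps are a fraction `O(1/n)` of all maps; the factor `n` on the left avoids the
exponent `h - 1`. -/
theorem mul_pow_sub_descFactorial_le {m n : ℕ} (hmn : m ≤ n) (h : ℕ) :
    (n : ℝ) * ((m : ℝ) ^ h - (m.descFactorial h : ℕ)) ≤ (h : ℝ) ^ 2 * (n : ℝ) ^ h := by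
  induction h with
  | zero => simp
  | succ h ih =>
    have hmn' : (m : ℝ) ≤ n := by exact_mod_cast hmn
    have h0 : (m.descFactorial h : ℝ) ≤ (n : ℝ) ^ h := by
      exact_mod_cast (Nat.descFactorial_le_pow m h).trans (Nat.pow_le_pow_left hmn h)
    have h1 : ((m : ℝ) - h) * (m.descFactorial h : ℕ) ≤ (m.descFactorial (h + 1) : ℕ) := by
      rw [Nat.descFactorial_succ]
      push_cast
      refine mul_le_mul_of_nonneg_right ?_ (by positivity)
      exact sub_le_iff_le_add.2 (by exact_mod_cast le_tsub_add)
    have e1 : (n : ℝ) * ((m : ℝ) ^ (h + 1) - ((m : ℝ) - h) * (m.descFactorial h : ℕ)) =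
        m * ((n : ℝ) * ((m : ℝ) ^ h - (m.descFactorial h : ℕ))) +
          h * (n * (m.descFactorial h : ℕ)) := by
      ring
    calc (n : ℝ) * ((m : ℝ) ^ (h + 1) - (m.descFactorial (h + 1) : ℕ))
        ≤ (n : ℝ) * ((m : ℝ) ^ (h + 1) - ((m : ℝ) - h) * (m.descFactorial h : ℕ)) := by gcongr
      _ ≤ n * ((h : ℝ) ^ 2 * (n : ℝ) ^ h) + h * (n * (n : ℝ) ^ h) := by
        rw [e1]
        exact add_le_add ((mul_le_mul_of_nonneg_left ih (by positivity)).trans (by gcongr))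
          (by gcongr)
      _ = ((h : ℝ) ^ 2 + h) * (n : ℝ) ^ (h + 1) := by ring
      _ ≤ _ := by
        refine mul_le_mul_of_nonneg_right ?_ (by positivity)
        push_cast; nlinarith [(by positivity : (0 : ℝ) ≤ h)]

end Tournament

open Finset in
/-- A function that changes sign when one coordinate is flipped has sum zero. -/
theorem sum_eq_zero_of_flip {ι : Type*} [Fintype ι] [DecidableEq ι] (e : ι) {F : (ι → Bool) → ℝ}
    (hF : ∀ ω, F (Function.update ω e (!ω e)) = -F ω) : ∑ ω, F ω = 0 := by
  have hinv : Function.Involutive fun ω : ι → Bool => Function.update ω e (!ω e) := by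
    intro ω; simp
  have h : ∑ ω, F (Function.update ω e (!ω e)) = ∑ ω, F ω := Equiv.sum_comp hinv.toPerm F
  simp only [hF, sum_neg_distrib] at h
  linarith

/-! ### Second moments of the biased random tournament. -/

namespace Tournament

open Finset

variable {n : ℕ}

/-- The probability of a value of one coordinate of the biased orientation. -/
noncomputable def bias (x : ℝ) (b : Bool) : ℝ := if b then (1 + x) / 2 else (1 - x) / 2

/-- The probability of an orientation in which forward edges have probability `(1 + x) / 2`. -/
noncomputable def biasWeight (x : ℝ) (ω : Pairs n → Bool) : ℝ := ∏ e, bias x (ω e)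

theorem bias_nonneg {x : ℝ} (hx0 : 0 ≤ x) (hx1 : x ≤ 1) (b : Bool) : 0 ≤ bias x b := by
  unfold bias; split_ifs <;> linarith

theorem biasWeight_nonneg {x : ℝ} (hx0 : 0 ≤ x) (hx1 : x ≤ 1) (ω : Pairs n → Bool) :
    0 ≤ biasWeight x ω := prod_nonneg fun _ _ => bias_nonneg hx0 hx1 _

theorem sum_biasWeight (x : ℝ) : ∑ ω : Pairs n → Bool, biasWeight x ω = 1 := by
  have h := Finset.prod_univ_sum (fun _ : Pairs n => (univ : Finset Bool)) fun _ b => bias x b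
  rw [Fintype.piFinset_univ] at h
  unfold biasWeight
  rw [← h]
  refine prod_eq_one fun e _ => ?_
  simp [bias]
  ring

/-- The deviation of the adjacency matrix from its expectation. -/
noncomputable def deviation (x : ℝ) (ω : Pairs n → Bool) (u v : Fin n) : ℝ :=
  (ofOrientation ω).adjMatrix u v - biasedMatrix x u v

theorem deviation_self (x : ℝ) (ω : Pairs n → Bool) (u : Fin n) : deviation x ω u u = 0 := by
  simp [deviation, biasedMatrix, adjMatrix_self]

theorem deviation_swap (x : ℝ) (ω : Pairs n → Bool) (u v : Fin n) :
    deviation x ω v u = -deviation x ω u v := by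
  by_cases h : u = v
  · subst h; simp [deviation_self]
  · have h1 := (ofOrientation ω).adjMatrix_add_swap h
    have h2 : biasedMatrix x u v + biasedMatrix x v u = 1 := by
      rw [biasedMatrix, biasedMatrix, if_neg h, if_neg (Ne.symm h), ordSign_swap u v]; ring
    unfold deviation
    linarith

theorem abs_deviation_le {x : ℝ} (hx0 : 0 ≤ x) (hx1 : x ≤ 1) (ω : Pairs n → Bool) (u v : Fin n) :
    |deviation x ω u v| ≤ 1 := by
  have h1 := (ofOrientation ω).adjMatrix_nonneg u v
  have h2 := (ofOrientation ω).adjMatrix_le_one u v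
  have h3 := biasedMatrix_mem hx0 hx1 u v
  rw [abs_le, deviation]
  constructor <;> linarith

theorem deviation_of_lt (x : ℝ) (ω : Pairs n → Bool) {u v : Fin n} (h : u < v) :
    deviation x ω u v = (if ω ⟨(u, v), h⟩ then 1 else 0) - (1 + x) / 2 := by
  simp [deviation, adjMatrix, ofOrientation_adj_of_lt ω h, biasedMatrix, h.ne, ordSign_of_lt h]

/-- At the flipped pair, weight times deviation is `(1 - x ^ 2) / 4` with the sign of the bit. -/
theorem biasWeight_flip_mul (x : ℝ) (ω : Pairs n → Bool) {u v : Fin n} (h : u < v) :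
    biasWeight x (Function.update ω ⟨(u, v), h⟩ (!ω ⟨(u, v), h⟩)) *
      deviation x (Function.update ω ⟨(u, v), h⟩ (!ω ⟨(u, v), h⟩)) u v =
      -(biasWeight x ω * deviation x ω u v) := by
  set e : Pairs n := ⟨(u, v), h⟩
  have h1 : ∏ e' ∈ univ.erase e, bias x (Function.update ω e (!ω e) e') =
      ∏ e' ∈ univ.erase e, bias x (ω e') := by
    refine prod_congr rfl fun e' he' => ?_
    rw [Function.update_of_ne (mem_erase.1 he').1]
  rw [deviation_of_lt x _ h, deviation_of_lt x _ h, biasWeight, biasWeight,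
    ← mul_prod_erase univ _ (mem_univ e),
    ← mul_prod_erase univ (fun e' => bias x (ω e')) (mem_univ e), h1]
  change bias x (Function.update ω e (!ω e) e) * _ *
    ((if Function.update ω e (!ω e) e = true then 1 else 0) - _) =
      -(_ * ((if ω e = true then 1 else 0) - _))
  rw [Function.update_self]
  cases ω e <;> simp [bias] <;> ring

/-- Every edge can be resampled: its deviation changes sign against the weight and all other
deviations stay the same. -/
theorem exists_flip {u v : Fin n} (huv : u ≠ v) : ∃ e : Pairs n,
    (∀ x ω, biasWeight x (Function.update ω e (!ω e)) *
      deviation x (Function.update ω e (!ω e)) u v = -(biasWeight x ω * deviation x ω u v)) ∧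
    ∀ x ω u' v', (u', v') ≠ (u, v) → (u', v') ≠ (v, u) →
      deviation x (Function.update ω e (!ω e)) u' v' = deviation x ω u' v' := by
  wlog h : u < v generalizing u v
  · obtain ⟨e, h1, h2⟩ := this huv.symm (lt_of_le_of_ne (not_lt.1 h) huv.symm)
    refine ⟨e, fun x ω => ?_, fun x ω u' v' h3 h4 => h2 x ω u' v' h4 h3⟩
    rw [deviation_swap x _ v u, deviation_swap x ω v u]
    have := h1 x ω
    linarith
  refine ⟨⟨(u, v), h⟩, fun x ω => biasWeight_flip_mul x ω h, ?_⟩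
  have key : ∀ x ω u' v', u' < v' → (u', v') ≠ (u, v) →
      deviation x (Function.update ω ⟨(u, v), h⟩ (!ω ⟨(u, v), h⟩)) u' v' = deviation x ω u' v' := by
    intro x ω u' v' hlt hne
    rw [deviation_of_lt x _ hlt, deviation_of_lt x _ hlt, Function.update_of_ne]
    intro h'
    exact hne (Subtype.ext_iff.1 h')
  intro x ω u' v' h1 h2
  rcases lt_trichotomy u' v' with h' | h' | h'
  · exact key x ω u' v' h' h1
  · subst h'; simp [deviation_self]
  · rw [deviation_swap x _ v' u', deviation_swap x ω v' u', key x ω v' u' h']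
    intro h3
    simp only [Prod.mk.injEq] at h3
    exact h2 (by simp [h3])

theorem abs_sum_biasWeight_mul_le {x : ℝ} (hx0 : 0 ≤ x) (hx1 : x ≤ 1) {F : (Pairs n → Bool) → ℝ}
    (hF : ∀ ω, |F ω| ≤ 1) : |∑ ω, biasWeight x ω * F ω| ≤ 1 := by
  refine (abs_sum_le_sum_abs _ _).trans ?_
  rw [← sum_biasWeight (n := n) x]
  refine sum_le_sum fun ω _ => ?_
  rw [abs_mul, abs_of_nonneg (biasWeight_nonneg hx0 hx1 ω)]
  exact mul_le_of_le_one_right (biasWeight_nonneg hx0 hx1 ω) (hF ω)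

/-- In a nondegenerate case the pair `{z, y}` occurs only once among the four factors, so flipping
it negates the sum. The cases `z = y` and `z = y'` contain a zero diagonal entry. -/
theorem sum_deviation_cycle_le {x : ℝ} (hx0 : 0 ≤ x) (hx1 : x ≤ 1) (y y' z z' : Fin n) :
    ∑ ω, biasWeight x ω * ((deviation x ω z y * deviation x ω z y') *
      (deviation x ω z' y * deviation x ω z' y')) ≤
      (if y = y' then 1 else 0) + if z = z' then 1 else 0 := by
  have hd := fun ω u v => abs_deviation_le (n := n) hx0 hx1 ω u v
  have hle : ∑ ω, biasWeight x ω * ((deviation x ω z y * deviation x ω z y') *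
      (deviation x ω z' y * deviation x ω z' y')) ≤ 1 := by
    refine (le_abs_self _).trans (abs_sum_biasWeight_mul_le hx0 hx1 fun ω => ?_)
    simp only [abs_mul]
    exact mul_le_one₀ (mul_le_one₀ (hd _ _ _) (abs_nonneg _) (hd _ _ _)) (by positivity)
      (mul_le_one₀ (hd _ _ _) (abs_nonneg _) (hd _ _ _))
  by_cases hy : y = y'
  · rw [if_pos hy]; split_ifs <;> linarith
  by_cases hz : z = z'
  · rw [if_pos hz, if_neg hy]; linarith
  rw [if_neg hy, if_neg hz, add_zero]
  by_cases h1 : z = y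
  · subst h1; simp [deviation_self]
  by_cases h2 : z = y'
  · subst h2; simp [deviation_self]
  obtain ⟨e, he1, he2⟩ := exists_flip h1
  refine (sum_eq_zero_of_flip e fun ω => ?_).le
  rw [he2 x ω z y' (by simp [Ne.symm hy]) (by simp [h1]),
    he2 x ω z' y (by simp [Ne.symm hz]) (by simp [Ne.symm h1]),
    he2 x ω z' y' (by simp [Ne.symm hz]) (by simp [Ne.symm h2])]
  linear_combination (deviation x ω z y' * (deviation x ω z' y * deviation x ω z' y')) * he1 x ω

theorem sum_deviation_mul_le {x : ℝ} (hx0 : 0 ≤ x) (hx1 : x ≤ 1) {p q : Fin n × Fin n}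
    (hp : p.1 < p.2) (hq : q.1 < q.2) :
    ∑ ω, biasWeight x ω * (deviation x ω p.1 p.2 * deviation x ω q.1 q.2) ≤
      if p = q then 1 else 0 := by
  split_ifs with h
  · refine (le_abs_self _).trans (abs_sum_biasWeight_mul_le hx0 hx1 fun ω => ?_)
    rw [abs_mul]
    exact mul_le_one₀ (abs_deviation_le hx0 hx1 _ _ _) (abs_nonneg _)
      (abs_deviation_le hx0 hx1 _ _ _)
  · obtain ⟨e, he1, he2⟩ := exists_flip hp.ne
    refine (sum_eq_zero_of_flip e fun ω => ?_).le
    rw [he2 x ω q.1 q.2 (by simpa using Ne.symm h)]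
    · linear_combination deviation x ω q.1 q.2 * he1 x ω
    · intro h'
      simp only [Prod.mk.injEq] at h'
      rw [h'.1, h'.2] at hq
      exact absurd hq hp.not_gt

/-- There is a tournament that deviates little from the biased matrix, both in codegrees and in
the number of forward edges. -/
theorem exists_small_deviation (n : ℕ) {x : ℝ} (hx0 : 0 ≤ x) (hx1 : x ≤ 1) :
    ∃ ω : Pairs n → Bool,
      (∑ y, ∑ y', (∑ z, deviation x ω z y * deviation x ω z y') ^ 2) +
        n * (∑ p : Fin n × Fin n with p.1 < p.2, deviation x ω p.1 p.2) ^ 2 ≤ 3 * (n : ℝ) ^ 3 := by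
  by_contra! hcon
  -- First-moment method: the two expectations are at most `2 * n ^ 3` and `n * n ^ 2`, so not every
  -- outcome exceeds `3 * n ^ 3`.
  have h1 : ∑ ω : Pairs n → Bool, biasWeight x ω *
      (∑ y, ∑ y', (∑ z, deviation x ω z y * deviation x ω z y') ^ 2) ≤ 2 * (n : ℝ) ^ 3 := by
    have e1 : ∑ ω : Pairs n → Bool, biasWeight x ω *
        (∑ y, ∑ y', (∑ z, deviation x ω z y * deviation x ω z y') ^ 2) =
        ∑ y : Fin n, ∑ y' : Fin n, ∑ z : Fin n, ∑ z' : Fin n, ∑ ω, biasWeight x ω * ((deviation x ω z y * deviation x ω z y') *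
          (deviation x ω z' y * deviation x ω z' y')) := by
      simp only [sq, sum_mul_sum]
      simp only [mul_sum]
      rw [sum_comm]
      refine sum_congr rfl fun y _ => ?_
      rw [sum_comm]
      refine sum_congr rfl fun y' _ => ?_
      rw [sum_comm]
      refine sum_congr rfl fun z _ => ?_
      rw [sum_comm]
    rw [e1]
    calc _ ≤ ∑ y : Fin n, ∑ y' : Fin n, ∑ z : Fin n, ∑ z' : Fin n,
          ((if y = y' then 1 else 0) + if z = z' then (1 : ℝ) else 0) := by
          gcongr with y _ y' _ z _ z' _
          exact sum_deviation_cycle_le hx0 hx1 y y' z z'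
      _ = 2 * (n : ℝ) ^ 3 := by
          simp [sum_add_distrib]
          ring
  have h2 : ∑ ω : Pairs n → Bool, biasWeight x ω *
      (∑ p : Fin n × Fin n with p.1 < p.2, deviation x ω p.1 p.2) ^ 2 ≤ (n : ℝ) ^ 2 := by
    have e1 : ∑ ω : Pairs n → Bool, biasWeight x ω *
        (∑ p : Fin n × Fin n with p.1 < p.2, deviation x ω p.1 p.2) ^ 2 =
        ∑ p : Fin n × Fin n with p.1 < p.2, ∑ q : Fin n × Fin n with q.1 < q.2,
          ∑ ω, biasWeight x ω * (deviation x ω p.1 p.2 * deviation x ω q.1 q.2) := by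
      simp only [sq, sum_mul_sum]
      simp only [mul_sum]
      rw [sum_comm]
      refine sum_congr rfl fun p _ => ?_
      rw [sum_comm]
    rw [e1]
    calc _ ≤ ∑ p : Fin n × Fin n with p.1 < p.2, ∑ q : Fin n × Fin n with q.1 < q.2,
          (if p = q then (1 : ℝ) else 0) := by
          refine sum_le_sum fun p hp => sum_le_sum fun q hq => ?_
          exact sum_deviation_mul_le hx0 hx1 (mem_filter.1 hp).2 (mem_filter.1 hq).2
      _ ≤ ∑ p : Fin n × Fin n, (1 : ℝ) := by
          refine (sum_le_sum fun p hp => ?_).trans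
            (sum_le_sum_of_subset_of_nonneg (filter_subset _ _) fun _ _ _ => zero_le_one)
          rw [sum_ite_eq]
          exact ite_le_one le_rfl zero_le_one
      _ = (n : ℝ) ^ 2 := by simp [sq]
  have h3 : 3 * (n : ℝ) ^ 3 < ∑ ω : Pairs n → Bool, biasWeight x ω *
      ((∑ y, ∑ y', (∑ z, deviation x ω z y * deviation x ω z y') ^ 2) +
        n * (∑ p : Fin n × Fin n with p.1 < p.2, deviation x ω p.1 p.2) ^ 2) := by
    have h4 : ∑ ω : Pairs n → Bool, biasWeight x ω * (3 * (n : ℝ) ^ 3) = 3 * (n : ℝ) ^ 3 := by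
      rw [← sum_mul, sum_biasWeight, one_mul]
    rw [← h4]
    refine sum_lt_sum (fun ω _ =>
      mul_le_mul_of_nonneg_left (hcon ω).le (biasWeight_nonneg hx0 hx1 ω)) ?_
    -- Single weights may vanish when `x = 1`; strictness needs just one positive weight, and the
    -- total is `1`.
    by_contra! hz
    have hzero : ∀ ω : Pairs n → Bool, biasWeight x ω = 0 := by
      intro ω
      by_contra hne
      have hpos : 0 < biasWeight x ω := lt_of_le_of_ne (biasWeight_nonneg hx0 hx1 ω) (Ne.symm hne)
      exact absurd (hz ω (mem_univ _)) (not_le.2 (mul_lt_mul_of_pos_left (hcon ω) hpos))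
    have := sum_biasWeight (n := n) x
    simp [hzero] at this
  have h5 : ∑ ω : Pairs n → Bool, biasWeight x ω *
      ((∑ y, ∑ y', (∑ z, deviation x ω z y * deviation x ω z y') ^ 2) +
        n * (∑ p : Fin n × Fin n with p.1 < p.2, deviation x ω p.1 p.2) ^ 2) =
      (∑ ω : Pairs n → Bool, biasWeight x ω *
        (∑ y, ∑ y', (∑ z, deviation x ω z y * deviation x ω z y') ^ 2)) +
      n * ∑ ω : Pairs n → Bool, biasWeight x ω *
        (∑ p : Fin n × Fin n with p.1 < p.2, deviation x ω p.1 p.2) ^ 2 := by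
    rw [mul_sum, ← sum_add_distrib]
    refine sum_congr rfl fun ω _ => ?_
    ring
  have h6 : (n : ℝ) * ∑ ω : Pairs n → Bool, biasWeight x ω *
      (∑ p : Fin n × Fin n with p.1 < p.2, deviation x ω p.1 p.2) ^ 2 ≤ n * (n : ℝ) ^ 2 := by
    gcongr
  rw [h5] at h3
  linarith [show (n : ℝ) * (n : ℝ) ^ 2 = (n : ℝ) ^ 3 by ring]

end Tournament

/-! ### From the order sum to a counterexample to local forcing. -/

namespace Tournament

open Finset

theorem ncard_forwardEdges_refl {n : ℕ} (x : ℝ) (ω : Pairs n → Bool) :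
    (((ofOrientation ω).forwardEdges (Equiv.refl _)).ncard : ℝ) =
      (∑ p : Fin n × Fin n with p.1 < p.2, deviation x ω p.1 p.2) +
        (1 + x) / 2 * (n.choose 2 : ℝ) := by
  classical
  have h1 : (ofOrientation ω).forwardEdges (Equiv.refl _) =
      (((univ.filter fun p : Fin n × Fin n => p.1 < p.2).filter
        fun p => (ofOrientation ω).Adj p.1 p.2 : Finset _) : Set (Fin n × Fin n)) := by
    ext p
    simp [forwardEdges, and_comm]
  have h2 : ∀ p ∈ univ.filter fun p : Fin n × Fin n => p.1 < p.2,
      deviation x ω p.1 p.2 =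
        (if (ofOrientation ω).Adj p.1 p.2 then 1 else 0) - (1 + x) / 2 := by
    intro p hp
    have hlt := (mem_filter.1 hp).2
    simp [deviation, adjMatrix, biasedMatrix, hlt.ne, ordSign_of_lt hlt]
  have h3 : #(univ.filter fun p : Fin n × Fin n => p.1 < p.2) = n.choose 2 := by
    rw [← card_pairs, Fintype.card_subtype]
  rw [h1, Set.ncard_coe_finset, sum_congr rfl h2, sum_sub_distrib, sum_const, h3, card_filter]
  push_cast
  rw [nsmul_eq_mul]
  ring

/-- Closeness to a biased matrix of the right density in cut norm gives the right local counts. -/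
theorem hasLocalCounts_of_cutNorm {h n : ℕ} (H : Tournament (Fin h)) (T : Tournament (Fin n))
    {x δ η : ℝ} (hx0 : 0 ≤ x) (hx1 : x ≤ 1) (hx : H.orderSum x = h.factorial)
    (hn0 : (0 : ℝ) < n) (hη : #H.edges * η ≤ δ / 2) (hnδ : 2 * (h : ℝ) ^ 2 ≤ δ * n)
    (hbil : ∀ a b : Fin n → ℝ, (∀ x, 0 ≤ a x ∧ a x ≤ 1) → (∀ x, 0 ≤ b x ∧ b x ≤ 1) →
      |∑ y, ∑ z, a y * b z * (T.adjMatrix y z - biasedMatrix x y z)| ≤ η * (n : ℝ) ^ 2) :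
    HasLocalCounts H δ T := by
  intro U
  rw [embCount_eq_sum]
  have h1 := counting_lemma (ι := Fin h)
    (fun y z => ⟨T.adjMatrix_nonneg y z, T.adjMatrix_le_one y z⟩)
    (biasedMatrix_mem hx0 hx1) hbil (setIndicator U) (setIndicator_mem U) H.edges
    (fun e he => ⟨ne_of_mem_edges he, fun h' =>
      H.not_adj_of_adj (mem_edges.1 he) (mem_edges.1 h')⟩)
  have h2 := H.sum_biasedMatrix x U
  set sumA := ∑ φ : Fin h → Fin n, (∏ k, setIndicator U (φ k)) *
    ∏ e ∈ H.edges, T.adjMatrix (φ e.1) (φ e.2)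
  set sumB := ∑ φ : Fin h → Fin n, (∏ k, setIndicator U (φ k)) *
    ∏ e ∈ H.edges, biasedMatrix x (φ e.1) (φ e.2)
  have hU : U.ncard ≤ n := by
    simpa [Nat.card_eq_fintype_card] using Set.ncard_le_card U
  -- Here `orderSum H x = h!` makes the bias invisible to the count. The error `δ` is split evenly
  -- between the cut norm and the passage from falling factorials to powers.
  have hB : sumB = (U.ncard.descFactorial h : ℕ) * (1 / 2) ^ h.choose 2 := by
    rw [hx] at h2
    have hf : (h.factorial : ℝ) ≠ 0 := by positivity
    apply mul_left_cancel₀ hf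
    rw [h2]; ring
  rw [Fintype.card_fin, Fintype.card_fin] at h1
  have hAB : |sumA - sumB| ≤ δ / 2 * (n : ℝ) ^ h := by
    have e1 : (#H.edges : ℝ) * (η * (n : ℝ) ^ 2 * (n : ℝ) ^ h) ≤ δ / 2 * (n : ℝ) ^ h * (n : ℝ) ^ 2 := by
      calc (#H.edges : ℝ) * (η * (n : ℝ) ^ 2 * (n : ℝ) ^ h) = #H.edges * η * ((n : ℝ) ^ h * (n : ℝ) ^ 2) := by ring
        _ ≤ δ / 2 * ((n : ℝ) ^ h * (n : ℝ) ^ 2) := by gcongr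
        _ = _ := by ring
    exact le_of_mul_le_mul_right (h1.trans e1) (by positivity)
  have hBm : |sumB - (1 / 2) ^ h.choose 2 * (U.ncard : ℝ) ^ h| ≤ δ / 2 * (n : ℝ) ^ h := by
    have e1 := mul_pow_sub_descFactorial_le hU h
    have e2 : (U.ncard.descFactorial h : ℝ) ≤ (U.ncard : ℝ) ^ h := by
      exact_mod_cast Nat.descFactorial_le_pow _ _
    have e3 : (U.ncard : ℝ) ^ h - (U.ncard.descFactorial h : ℕ) ≤ δ / 2 * (n : ℝ) ^ h := by
      refine le_of_mul_le_mul_left (a := (n : ℝ)) (e1.trans ?_) hn0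
      have : (h : ℝ) ^ 2 * (n : ℝ) ^ h ≤ δ * n / 2 * (n : ℝ) ^ h :=
        mul_le_mul_of_nonneg_right (by linarith) (by positivity)
      linarith
    have e4 : (0 : ℝ) ≤ (1 / 2) ^ h.choose 2 := by positivity
    have e5 : (1 / 2 : ℝ) ^ h.choose 2 ≤ 1 := pow_le_one₀ (by norm_num) (by norm_num)
    rw [hB, abs_sub_comm, abs_of_nonneg (by nlinarith)]
    nlinarith
  calc |sumA - (1 / 2) ^ h.choose 2 * (U.ncard : ℝ) ^ h| ≤ |sumA - sumB| +
        |sumB - (1 / 2) ^ h.choose 2 * (U.ncard : ℝ) ^ h| := abs_sub_le _ _ _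
    _ ≤ δ * (n : ℝ) ^ h := by linarith

/-- The identity ordering has an excess of `x * n * (n - 1) / 4 ≥ x * n ^ 2 / 8` forward edges, up
to a deviation of at most `2 * n`. This beats `x * n ^ 2 / 16` once `x * n > 32`. -/
theorem not_isQuasirandomWith_of_sum_deviation {n : ℕ} {x : ℝ} (hx0 : 0 < x) (ω : Pairs n → Bool)
    (hn2 : (2 : ℝ) ≤ n) (hnx : 33 ≤ x * n)
    (hS3 : (∑ p : Fin n × Fin n with p.1 < p.2, deviation x ω p.1 p.2) ^ 2 ≤ 3 * (n : ℝ) ^ 2) :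
    ¬ IsQuasirandomWith (x / 16) (ofOrientation ω) := by
  intro hqr
  have hq := hqr (Equiv.refl _)
  rw [ncard_forwardEdges_refl x ω, Nat.cast_choose_two] at hq
  have hq := (abs_le.1 hq).2
  have hn0 : (0 : ℝ) < n := by linarith
  have hS4 := (abs_le.1 (abs_le_of_sq_le_sq (hS3.trans (by nlinarith) : _ ≤ (2 * (n : ℝ)) ^ 2)
    (by positivity))).1
  have h6 : x / 2 * ((n : ℝ) * (n - 1) / 2) ≤ x / 16 * (n : ℝ) ^ 2 + 2 * n := by linarith
  have h7 : 0 ≤ x * n * ((n : ℝ) - 1 - n / 2) :=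
    mul_nonneg (by positivity) (by linarith)
  have h8 : 0 ≤ (x * n - 33) * (n : ℝ) := mul_nonneg (by linarith) hn0.le
  nlinarith

/-- A tournament that has the right density in some biased random tournament is not locally
forcing. -/
theorem not_locallyForcing_of_orderSum_eq {h : ℕ} (H : Tournament (Fin h)) {x : ℝ} (hx0 : 0 < x)
    (hx1 : x ≤ 1) (hx : H.orderSum x = h.factorial) : ¬ H.LocallyForcing := by
  intro hLF
  obtain ⟨δ, hδ, n₀, hn₀⟩ := hLF (x / 16) (by positivity)
  set m : ℝ := (#H.edges : ℝ) with hm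
  have hm0 : 0 ≤ m := by positivity
  -- The cut-norm error per edge; `m + 1` covers the case that `H` has no edges.
  set η : ℝ := δ / (2 * (m + 1)) with hη
  have hη0 : 0 < η := by positivity
  -- The last three terms serve the cut norm (`3 * n ^ 7 ≤ (η * n ^ 2) ^ 4`), the falling factorial
  -- and the forward-edge excess.
  obtain ⟨n, hn⟩ := exists_nat_ge (n₀ + 2 + 3 / η ^ 4 + 2 * (h : ℝ) ^ 2 / δ + 33 / x)
  have p1 : (0 : ℝ) ≤ 3 / η ^ 4 := by positivity
  have p2 : (0 : ℝ) ≤ 2 * (h : ℝ) ^ 2 / δ := by positivity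
  have p3 : (0 : ℝ) ≤ 33 / x := by positivity
  have p4 : (0 : ℝ) ≤ n₀ := by positivity
  have hnn₀ : n₀ ≤ n := by
    have : (n₀ : ℝ) ≤ n := by linarith
    exact_mod_cast this
  have hn2 : (2 : ℝ) ≤ n := by linarith
  have hn0 : (0 : ℝ) < n := by linarith
  have hnη : 3 ≤ η ^ 4 * n := by
    have : 3 / η ^ 4 ≤ n := by linarith
    rw [div_le_iff₀ (by positivity)] at this
    linarith
  have hnδ : 2 * (h : ℝ) ^ 2 ≤ δ * n := by
    have : 2 * (h : ℝ) ^ 2 / δ ≤ n := by linarith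
    rw [div_le_iff₀ hδ] at this
    linarith
  have hnx : 33 ≤ x * n := by
    have : 33 / x ≤ n := by linarith
    rw [div_le_iff₀ hx0] at this
    linarith
  obtain ⟨ω, hω⟩ := exists_small_deviation n hx0.le hx1
  set D := ∑ y, ∑ y', (∑ z, deviation x ω z y * deviation x ω z y') ^ 2 with hD
  set S := ∑ p : Fin n × Fin n with p.1 < p.2, deviation x ω p.1 p.2 with hS
  have hD0 : 0 ≤ D := sum_nonneg fun _ _ => sum_nonneg fun _ _ => sq_nonneg _
  have hD3 : D ≤ 3 * (n : ℝ) ^ 3 := by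
    have : 0 ≤ (n : ℝ) * S ^ 2 := by positivity
    linarith
  have hS3 : S ^ 2 ≤ 3 * (n : ℝ) ^ 2 := by
    have : (n : ℝ) * S ^ 2 ≤ n * (3 * (n : ℝ) ^ 2) := by nlinarith
    exact le_of_mul_le_mul_left this hn0
  have hbil : ∀ a b : Fin n → ℝ, (∀ x, 0 ≤ a x ∧ a x ≤ 1) → (∀ x, 0 ≤ b x ∧ b x ≤ 1) →
      |∑ y, ∑ z, a y * b z * ((ofOrientation ω).adjMatrix y z - biasedMatrix x y z)| ≤
        η * (n : ℝ) ^ 2 := by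
    intro a b ha hb
    have h1 := abs_bilinear_pow_le (deviation x ω) a b ha hb
    rw [Fintype.card_fin] at h1
    refine le_of_pow_le_pow_left₀ (n := 4) (by norm_num) (by positivity) ?_
    refine h1.trans ?_
    calc (n : ℝ) ^ 4 * D ≤ (n : ℝ) ^ 4 * (3 * (n : ℝ) ^ 3) := by gcongr
      _ ≤ (n : ℝ) ^ 4 * (η ^ 4 * n * (n : ℝ) ^ 3) := by gcongr
      _ = (η * (n : ℝ) ^ 2) ^ 4 := by ring
  have hmη : m * η ≤ δ / 2 := by
    rw [hη, ← mul_div_assoc, div_le_iff₀ (by positivity)]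
    nlinarith
  exact not_isQuasirandomWith_of_sum_deviation hx0 ω hn2 hnx hS3 (hn₀ n hnn₀ _
    (H.hasLocalCounts_of_cutNorm _ hx0.le hx1 hx hn0 hmη hnδ hbil))

end Tournament

/-! ### The quadratic term of the order sum. -/

namespace Tournament

open Finset

variable {h : ℕ}

/-- The correlation of the relative orders of two pairs in a uniformly random ordering. -/
noncomputable def orderCorr (u v w z : Fin h) : ℝ :=
  ∑ π : Equiv.Perm (Fin h), ordSign (π u) (π v) * ordSign (π w) (π z)

theorem orderCorr_perm (ρ : Equiv.Perm (Fin h)) (u v w z : Fin h) :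
    orderCorr (ρ u) (ρ v) (ρ w) (ρ z) = orderCorr u v w z :=
  Equiv.sum_comp (Equiv.mulRight ρ) fun π : Equiv.Perm (Fin h) =>
    ordSign (π u) (π v) * ordSign (π w) (π z)

theorem orderCorr_swap_left (u v w z : Fin h) : orderCorr v u w z = -orderCorr u v w z := by
  simp only [orderCorr, ← sum_neg_distrib]
  refine sum_congr rfl fun π _ => ?_
  rw [ordSign_swap (π u) (π v)]; ring

theorem orderCorr_comm (u v w z : Fin h) : orderCorr w z u v = orderCorr u v w z := by
  simp only [orderCorr]
  exact sum_congr rfl fun π _ => mul_comm _ _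

theorem orderCorr_swap_right (u v w z : Fin h) : orderCorr u v z w = -orderCorr u v w z := by
  rw [orderCorr_comm, orderCorr_swap_left, orderCorr_comm]

theorem orderCorr_self {u v : Fin h} (huv : u ≠ v) : orderCorr u v u v = h.factorial := by
  have : ∀ π : Equiv.Perm (Fin h), ordSign (π u) (π v) * ordSign (π u) (π v) = 1 := fun π =>
    ordSign_sq (π.injective.ne huv)
  simp [orderCorr, this, Fintype.card_perm]

/-- Swapping `u` and `v` reverses the first sign and fixes the second, so the correlation equals its
own negative. -/
theorem orderCorr_disjoint {u v w z : Fin h} (huw : u ≠ w) (huz : u ≠ z) (hvw : v ≠ w)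
    (hvz : v ≠ z) : orderCorr u v w z = 0 := by
  have h1 := orderCorr_perm (Equiv.swap u v) u v w z
  rw [Equiv.swap_apply_left, Equiv.swap_apply_right,
    Equiv.swap_apply_of_ne_of_ne huw.symm hvw.symm,
    Equiv.swap_apply_of_ne_of_ne huz.symm hvz.symm, orderCorr_swap_left] at h1
  linarith

/-- By symmetry the correlations centred at `u`, `v` and `w` agree, and by `ordSign_triple` they add
up to `h!`. -/
theorem orderCorr_star {u v w : Fin h} (huv : u ≠ v) (huw : u ≠ w) (hvw : v ≠ w) :
    3 * orderCorr u v u w = h.factorial := by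
  have h1 := orderCorr_perm (Equiv.swap u v) u v u w
  rw [Equiv.swap_apply_left, Equiv.swap_apply_right,
    Equiv.swap_apply_of_ne_of_ne huw.symm hvw.symm] at h1
  have h2 := orderCorr_perm (Equiv.swap u w) u w u v
  rw [Equiv.swap_apply_left, Equiv.swap_apply_right,
    Equiv.swap_apply_of_ne_of_ne huv.symm hvw] at h2
  have h3 : orderCorr u v u w + orderCorr v u v w + orderCorr w u w v = h.factorial := by
    simp only [orderCorr, ← sum_add_distrib]
    rw [sum_congr rfl fun π _ => ordSign_triple (π.injective.ne huv) (π.injective.ne huw)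
      (π.injective.ne hvw)]
    simp [Fintype.card_perm]
  rw [orderCorr_comm u v u w] at h2
  linarith

/-- One formula for all cases: a shared endpoint contributes `±1/3`. When the pairs coincide, two
such terms give `±2/3` and a nested indicator supplies the rest. -/
theorem orderCorr_eq {u v w z : Fin h} (huv : u ≠ v) (hwz : w ≠ z) :
    3 * orderCorr u v w z = h.factorial * ((if u = w then 1 else 0) - (if u = z then 1 else 0)
      - (if v = w then 1 else 0) + (if v = z then 1 else 0)
      + (if u = w then if v = z then 1 else 0 else 0)
      - (if u = z then if v = w then 1 else 0 else 0)) := by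
  by_cases h1 : u = w
  · subst h1
    by_cases h2 : v = z
    · subst h2
      simp [orderCorr_self huv, huv, huv.symm]; ring
    · simp [orderCorr_star huv hwz h2, hwz, huv.symm, h2]
  by_cases h2 : u = z
  · subst h2
    rw [orderCorr_swap_right]
    by_cases h3 : v = w
    · subst h3
      simp [orderCorr_self huv, huv, huv.symm]; ring
    · have := orderCorr_star huv h1 h3
      simp [h1, h3, huv.symm]; linarith
  by_cases h3 : v = w
  · subst h3
    rw [orderCorr_swap_left]
    have := orderCorr_star huv.symm hwz h2
    simp [h1, h2, hwz]; linarith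
  by_cases h4 : v = z
  · subst h4
    rw [orderCorr_swap_left, orderCorr_swap_right]
    have := orderCorr_star huv.symm h3 h1
    simp [h1, h2, h3]; linarith
  · simp [h1, h2, h3, h4, orderCorr_disjoint h1 h2 h3 h4]

/-- The number of forward edges minus the number of backward edges of `H` in an ordering. -/
noncomputable def orderBalance (H : Tournament (Fin h)) (π : Equiv.Perm (Fin h)) : ℝ :=
  ∑ e ∈ H.edges, ordSign (π e.1) (π e.2)

theorem two_mul_orderBalance (H : Tournament (Fin h)) (π : Equiv.Perm (Fin h)) :
    2 * H.orderBalance π = ∑ u, ∑ v, H.skew u v * ordSign (π u) (π v) :=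
  H.sum_edges_skew (fun u v => ordSign (π u) (π v)) fun _ _ => ordSign_swap _ _

theorem sum_orderBalance (H : Tournament (Fin h)) : ∑ π, H.orderBalance π = 0 := by
  unfold orderBalance
  rw [sum_comm]
  refine sum_eq_zero fun e _ => ?_
  have h1 := Equiv.sum_comp (Equiv.mulRight (Equiv.swap e.1 e.2)) fun π : Equiv.Perm (Fin h) =>
    ordSign (π e.1) (π e.2)
  simp only [Equiv.coe_mulRight, Equiv.Perm.coe_mul, Function.comp_apply, Equiv.swap_apply_left,
    Equiv.swap_apply_right] at h1
  have h2 : ∑ π : Equiv.Perm (Fin h), ordSign (π e.2) (π e.1) =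
      -∑ π : Equiv.Perm (Fin h), ordSign (π e.1) (π e.2) := by
    rw [← sum_neg_distrib]
    exact sum_congr rfl fun π _ => ordSign_swap _ _
  linarith

theorem sum_skew_mul_self (H : Tournament (Fin h)) :
    ∑ u, ∑ v, H.skew u v * H.skew u v = (h : ℝ) * (h - 1) := by
  have := sum_ne_one (V := Fin h)
  rw [Fintype.card_fin] at this
  rw [← this]
  refine sum_congr rfl fun u _ => sum_congr rfl fun v _ => ?_
  by_cases huv : u = v
  · simp [huv, skew_self]
  · simp [huv, skew_mul_self]

/-- After expanding the square, each of the four single coincidences contributes the sum of squared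
row sums, and each of the two double ones contributes `h(h-1)`. -/
theorem sum_orderBalance_sq (H : Tournament (Fin h)) :
    6 * ∑ π, H.orderBalance π ^ 2 =
      h.factorial * (2 * ∑ u, (∑ v, H.skew u v) ^ 2 + (h : ℝ) * (h - 1)) := by
  have e1 : ∑ π, (2 * H.orderBalance π) ^ 2 = ∑ u, ∑ v, ∑ w, ∑ z,
      H.skew u v * H.skew w z * orderCorr u v w z := by
    simp only [two_mul_orderBalance, sq, sum_mul]
    simp only [orderCorr, mul_sum]
    rw [sum_comm]
    refine sum_congr rfl fun u _ => ?_
    rw [sum_comm]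
    refine sum_congr rfl fun v _ => ?_
    rw [sum_comm]
    refine sum_congr rfl fun w _ => ?_
    rw [sum_comm]
    refine sum_congr rfl fun z _ => sum_congr rfl fun π _ => ?_
    ring
  have e2 : ∀ u v w z, 3 * (H.skew u v * H.skew w z * orderCorr u v w z) =
      h.factorial * (H.skew u v * H.skew w z * ((if u = w then 1 else 0) - (if u = z then 1 else 0)
      - (if v = w then 1 else 0) + (if v = z then 1 else 0)
      + (if u = w then if v = z then 1 else 0 else 0)
      - (if u = z then if v = w then 1 else 0 else 0))) := by
    intro u v w z
    by_cases huv : u = v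
    · simp [huv, skew_self]
    by_cases hwz : w = z
    · simp [hwz, skew_self]
    have := orderCorr_eq huv hwz
    linear_combination (H.skew u v * H.skew w z) * this
  have hs : ∀ u, ∑ v, H.skew v u = -∑ v, H.skew u v := by
    intro u
    rw [← sum_neg_distrib]
    exact sum_congr rfl fun v _ => H.skew_swap u v
  have e3 : 3 * ∑ π, (2 * H.orderBalance π) ^ 2 = h.factorial *
      (4 * ∑ u, (∑ v, H.skew u v) ^ 2 + 2 * ((h : ℝ) * (h - 1))) := by
    have a0 : 3 * ∑ u, ∑ v, ∑ w, ∑ z, H.skew u v * H.skew w z * orderCorr u v w z =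
        h.factorial * ∑ u, ∑ v, ∑ w, ∑ z, H.skew u v * H.skew w z *
      ((if u = w then 1 else 0) - (if u = z then 1 else 0)
      - (if v = w then 1 else 0) + (if v = z then 1 else 0)
      + (if u = w then if v = z then 1 else 0 else 0)
      - (if u = z then if v = w then 1 else 0 else 0)) := by
      simp only [mul_sum]
      exact sum_congr rfl fun u _ => sum_congr rfl fun v _ => sum_congr rfl fun w _ =>
        sum_congr rfl fun z _ => e2 u v w z
    have a1 : ∑ u, ∑ v, ∑ z, H.skew u v * H.skew u z = ∑ u, (∑ v, H.skew u v) ^ 2 := by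
      simp only [sq, sum_mul_sum]
    have a2 : ∑ u, ∑ v, ∑ w, H.skew u v * H.skew w u = -∑ u, (∑ v, H.skew u v) ^ 2 := by
      rw [← sum_neg_distrib]
      refine sum_congr rfl fun u _ => ?_
      rw [← sum_mul_sum, hs]; ring
    have a3 : ∑ u, ∑ v, ∑ z, H.skew u v * H.skew v z = -∑ u, (∑ v, H.skew u v) ^ 2 := by
      rw [sum_comm, ← sum_neg_distrib]
      refine sum_congr rfl fun u _ => ?_
      rw [← sum_mul_sum, hs]; ring
    have a4 : ∑ u, ∑ v, ∑ w, H.skew u v * H.skew w v = ∑ u, (∑ v, H.skew u v) ^ 2 := by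
      rw [sum_comm]
      refine sum_congr rfl fun u _ => ?_
      rw [← sum_mul_sum, hs]; ring
    have a5 : ∑ u, ∑ v, H.skew u v * H.skew v u = -∑ u, ∑ v, H.skew u v * H.skew u v := by
      simp only [← sum_neg_distrib]
      refine sum_congr rfl fun u _ => sum_congr rfl fun v _ => ?_
      rw [H.skew_swap u v]; ring
    rw [e1, ← H.sum_skew_mul_self, a0]
    congr 1
    simp only [mul_add, mul_sub, sum_add_distrib, sum_sub_distrib, mul_ite, mul_one, mul_zero,
      sum_ite_irrel, sum_const_zero, sum_ite_eq, mem_univ, if_true, a1, a2, a3, a4, a5]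
    ring
  have e4 : ∑ π, (2 * H.orderBalance π) ^ 2 = 4 * ∑ π, H.orderBalance π ^ 2 := by
    rw [mul_sum]
    refine sum_congr rfl fun π _ => ?_
    ring
  rw [e4] at e3
  linarith

/-- Lower Taylor bound for a product of linear factors with coefficients `±1`. -/
theorem exists_prod_one_add_ge {ι : Type*} [DecidableEq ι] (E : Finset ι) (s : ι → ℝ)
    (hs : ∀ e ∈ E, s e = 1 ∨ s e = -1) : ∃ C : ℝ, 0 ≤ C ∧ ∀ x : ℝ, 0 ≤ x → x ≤ 1 →
      1 + (∑ e ∈ E, s e) * x + ((∑ e ∈ E, s e) ^ 2 - #E) / 2 * x ^ 2 - C * x ^ 3 ≤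
        ∏ e ∈ E, (1 + x * s e) := by
  induction E using Finset.induction_on with
  | empty => exact ⟨0, le_rfl, fun x _ _ => by simp⟩
  | insert e E he ih =>
    obtain ⟨C, hC, ih⟩ := ih fun e he => hs e (mem_insert_of_mem he)
    set D := ∑ e ∈ E, s e with hD
    set q := (D ^ 2 - #E) / 2 with hq
    -- Multiplying by `1 + x * s e` creates the cubic term `s e * q`, absorbed by `|q|`, and at most
    -- doubles the old error.
    refine ⟨2 * C + |q|, by positivity, fun x hx0 hx1 => ?_⟩
    rw [sum_insert he, prod_insert he, card_insert_of_notMem he]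
    have hse := hs e (mem_insert_self _ _)
    have hse2 : s e ^ 2 = 1 := by rcases hse with h | h <;> simp [h]
    have hpos : 0 ≤ 1 + x * s e := by rcases hse with h | h <;> rw [h] <;> linarith
    refine le_trans ?_ (mul_le_mul_of_nonneg_left (ih x hx0 hx1) hpos)
    have hx3 : 0 ≤ x ^ 3 := by positivity
    have e1 : ((s e + D) ^ 2 - ((#E + 1 : ℕ) : ℝ)) / 2 = q + s e * D := by
      push_cast
      rw [hq]
      linear_combination hse2 / 2
    have e2 : (1 + x * s e) * (1 + D * x + q * x ^ 2 - C * x ^ 3) -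
        (1 + (s e + D) * x + (q + s e * D) * x ^ 2 - (2 * C + |q|) * x ^ 3) =
        x ^ 3 * (s e * q + |q| + C * (1 - s e * x)) := by ring
    have h1 : 0 ≤ s e * q + |q| := by
      rcases hse with h | h <;> rw [h]
      · linarith [neg_abs_le q]
      · linarith [le_abs_self q]
    have h2 : 0 ≤ C * (1 - s e * x) := by
      refine mul_nonneg hC ?_
      rcases hse with h | h <;> rw [h] <;> linarith
    have h3 : 0 ≤ x ^ 3 * (s e * q + |q| + C * (1 - s e * x)) :=
      mul_nonneg hx3 (by linarith)
    rw [e1]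
    linarith

/-- If the scores of `H` are spread out, then mildly biased tournaments contain more copies of `H`
than expected. -/
theorem exists_orderSum_gt (H : Tournament (Fin h))
    (hQ : (h : ℝ) * (h - 1) < ∑ u, (∑ v, H.skew u v) ^ 2) :
    ∃ x, 0 < x ∧ x ≤ 1 ∧ (h.factorial : ℝ) < H.orderSum x := by
  have hC : ∀ π : Equiv.Perm (Fin h), _ := fun π =>
    exists_prod_one_add_ge H.edges (fun e => ordSign (π e.1) (π e.2)) fun e he =>
      ordSign_eq_one_or (π.injective.ne (ne_of_mem_edges he))
  choose C hC0 hC using hC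
  set CC := ∑ π, C π with hCC
  have hCC0 : 0 ≤ CC := sum_nonneg fun π _ => hC0 π
  -- The `x ^ 2` coefficient of `orderSum`, that is, half the sum of `orderBalance ^ 2 - C(h,2)`
  -- over all orderings.
  set c := (h.factorial : ℝ) * (∑ u, (∑ v, H.skew u v) ^ 2 - h * (h - 1)) / 6 with hc
  have hc0 : 0 < c := by
    have : (0 : ℝ) < h.factorial := by positivity
    have := mul_pos this (sub_pos.2 hQ)
    rw [hc]; linarith
  have hlow : ∀ x, 0 ≤ x → x ≤ 1 → (h.factorial : ℝ) + c * x ^ 2 - CC * x ^ 3 ≤ H.orderSum x := by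
    intro x hx0 hx1
    have h1 : ∑ π : Equiv.Perm (Fin h), (1 + H.orderBalance π * x +
        (H.orderBalance π ^ 2 - #H.edges) / 2 * x ^ 2 - C π * x ^ 3) ≤ H.orderSum x :=
      sum_le_sum fun π _ => hC π x hx0 hx1
    refine le_of_eq_of_le ?_ h1
    rw [sum_sub_distrib, sum_add_distrib, sum_add_distrib, ← sum_mul, ← sum_mul, ← sum_mul,
      ← sum_div, sum_sub_distrib, sum_orderBalance, card_edges, Fintype.card_fin,
      Nat.cast_choose_two]
    have := H.sum_orderBalance_sq
    simp only [sum_const, card_univ, Fintype.card_perm, Fintype.card_fin, nsmul_eq_mul]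
    rw [hc]
    linear_combination -x ^ 2 / 12 * this
  refine ⟨min 1 (c / (2 * (CC + 1))), by positivity, min_le_left _ _, ?_⟩
  set x := min 1 (c / (2 * (CC + 1))) with hx
  have hx0 : 0 < x := by positivity
  have hxc : x * (2 * (CC + 1)) ≤ c := by
    rw [← le_div_iff₀ (by positivity)]; exact min_le_right _ _
  refine lt_of_lt_of_le ?_ (hlow x hx0.le (min_le_left _ _))
  have : 0 < x ^ 2 * (c - CC * x) := mul_pos (by positivity) (by nlinarith)
  nlinarith

/-- Without a transitive ordering every product at `x = 1` has a zero factor, so `orderSum` falls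
from above `h!` to `0` and passes through `h!`. -/
theorem not_locallyForcing_of_scores (H : Tournament (Fin h))
    (hQ : (h : ℝ) * (h - 1) < ∑ u, (∑ v, H.skew u v) ^ 2)
    (hH : ¬ ∃ σ : Equiv.Perm (Fin h), ∀ u v, H.Adj u v → σ u < σ v) : ¬ H.LocallyForcing := by
  obtain ⟨x₀, hx0, hx1, hlt⟩ := H.exists_orderSum_gt hQ
  have hone : H.orderSum 1 = 0 := by
    refine sum_eq_zero fun π _ => ?_
    push Not at hH
    obtain ⟨u, v, huv, hle⟩ := hH π
    refine prod_eq_zero (i := (u, v)) (mem_edges.2 huv) ?_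
    have hne : u ≠ v := by rintro rfl; exact H.irrefl _ huv
    rw [ordSign_of_gt (lt_of_le_of_ne hle (π.injective.ne hne.symm))]
    norm_num
  have hcont : Continuous H.orderSum := by
    unfold orderSum
    fun_prop
  obtain ⟨x, hx, hxe⟩ := intermediate_value_Icc' hx1 hcont.continuousOn
    (show (h.factorial : ℝ) ∈ Set.Icc (H.orderSum 1) (H.orderSum x₀) from
      ⟨by rw [hone]; positivity, hlt.le⟩)
  exact H.not_locallyForcing_of_orderSum_eq (hx0.trans_le hx.1) hx.2 hxe

end Tournament

/-! ### Moments of Rademacher chaos on the discrete cube. -/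

section cube

open Finset

variable {ι : Type*} [DecidableEq ι]

/-- A bit as a sign. -/
noncomputable def boolSign (b : Bool) : ℝ := if b then 1 else -1

theorem boolSign_sq (b : Bool) : boolSign b ^ 2 = 1 := by cases b <;> simp [boolSign]

theorem boolSign_not (b : Bool) : boolSign (!b) = -boolSign b := by cases b <;> simp [boolSign]

/-- A function on the cube does not depend on the coordinate `i`. -/
def FlipInvariant (i : ι) (f : (ι → Bool) → ℝ) : Prop :=
  ∀ ω, f (Function.update ω i (!ω i)) = f ω

/-- The Rademacher sum with coefficients `a` over the coordinates in `s`. -/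
noncomputable def linearChaos (a : ι → ℝ) (s : Finset ι) (ω : ι → Bool) : ℝ :=
  ∑ e ∈ s, a e * boolSign (ω e)

/-- The quadratic Rademacher chaos with coefficients `m` over the coordinates in `s`. -/
noncomputable def quadraticChaos (m : ι → ι → ℝ) (s : Finset ι) (ω : ι → Bool) : ℝ :=
  ∑ e ∈ s, ∑ e' ∈ s, m e e' * (boolSign (ω e) * boolSign (ω e'))

theorem linearChaos_flipInvariant (a : ι → ℝ) {s : Finset ι} {i : ι} (hi : i ∉ s) :
    FlipInvariant i (linearChaos a s) := by
  intro ω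
  refine sum_congr rfl fun e he => ?_
  rw [Function.update_of_ne (ne_of_mem_of_not_mem he hi)]

theorem quadraticChaos_flipInvariant (m : ι → ι → ℝ) {s : Finset ι} {i : ι} (hi : i ∉ s) :
    FlipInvariant i (quadraticChaos m s) := by
  intro ω
  refine sum_congr rfl fun e he => sum_congr rfl fun e' he' => ?_
  rw [Function.update_of_ne (ne_of_mem_of_not_mem he hi),
    Function.update_of_ne (ne_of_mem_of_not_mem he' hi)]

/-- The induction step for all moment bounds: the new sign enters linearly, with coefficients
independent of it. -/
theorem quadraticChaos_insert {m : ι → ι → ℝ} (hm : ∀ e, m e e = 0) {s : Finset ι} {i : ι}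
    (hi : i ∉ s) : quadraticChaos m (insert i s) = fun ω => quadraticChaos m s ω +
      boolSign (ω i) * linearChaos (fun e => m i e + m e i) s ω := by
  funext ω
  simp only [quadraticChaos, linearChaos, sum_insert hi, hm, zero_mul, zero_add, sum_add_distrib,
    mul_sum]
  rw [← add_assoc, ← sum_add_distrib, add_comm]
  congr 1
  refine sum_congr rfl fun e _ => ?_
  ring

variable [Fintype ι]

/-- The mean of a function on the discrete cube. -/
noncomputable def cubeMean (f : (ι → Bool) → ℝ) : ℝ := (∑ ω, f ω) / 2 ^ Fintype.card ι

theorem cubeMean_add (f g : (ι → Bool) → ℝ) :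
    cubeMean (fun ω => f ω + g ω) = cubeMean f + cubeMean g := by
  simp [cubeMean, sum_add_distrib, add_div]

theorem cubeMean_const_mul (c : ℝ) (f : (ι → Bool) → ℝ) :
    cubeMean (fun ω => c * f ω) = c * cubeMean f := by
  simp [cubeMean, ← mul_sum, mul_div_assoc]

theorem cubeMean_mono {f g : (ι → Bool) → ℝ} (h : ∀ ω, f ω ≤ g ω) : cubeMean f ≤ cubeMean g :=
  div_le_div_of_nonneg_right (sum_le_sum fun ω _ => h ω) (by positivity)

theorem cubeMean_nonneg {f : (ι → Bool) → ℝ} (h : ∀ ω, 0 ≤ f ω) : 0 ≤ cubeMean f :=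
  div_nonneg (sum_nonneg fun ω _ => h ω) (by positivity)

theorem cubeMean_mul_sq_le (f g : (ι → Bool) → ℝ) :
    cubeMean (fun ω => f ω * g ω) ^ 2 ≤
      cubeMean (fun ω => f ω ^ 2) * cubeMean (fun ω => g ω ^ 2) := by
  unfold cubeMean
  rw [div_pow, div_mul_div_comm, ← sq]
  exact div_le_div_of_nonneg_right (sum_mul_sq_le_sq_mul_sq _ _ _) (by positivity)

theorem cubeMean_pos {f : (ι → Bool) → ℝ} (h : ∀ ω, 0 ≤ f ω) {ω₀ : ι → Bool} (h₀ : 0 < f ω₀) :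
    0 < cubeMean f :=
  div_pos (sum_pos' (fun ω _ => h ω) ⟨ω₀, mem_univ _, h₀⟩) (by positivity)

theorem cubeMean_sign_mul {i : ι} {f : (ι → Bool) → ℝ} (hf : FlipInvariant i f) :
    cubeMean (fun ω => boolSign (ω i) * f ω) = 0 := by
  rw [cubeMean, sum_eq_zero_of_flip i, zero_div]
  intro ω
  rw [hf ω, Function.update_self, boolSign_not]
  ring

theorem cubeMean_add_sign_mul {i : ι} {A B : (ι → Bool) → ℝ} (hB : FlipInvariant i B) :
    cubeMean (fun ω => A ω + boolSign (ω i) * B ω) = cubeMean A := by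
  rw [cubeMean_add, cubeMean_sign_mul hB, add_zero]

theorem cubeMean_add_sign_mul_sq {i : ι} {A B : (ι → Bool) → ℝ} (hA : FlipInvariant i A)
    (hB : FlipInvariant i B) :
    cubeMean (fun ω => (A ω + boolSign (ω i) * B ω) ^ 2) =
      cubeMean (fun ω => A ω ^ 2) + cubeMean (fun ω => B ω ^ 2) := by
  have h1 : (fun ω => (A ω + boolSign (ω i) * B ω) ^ 2) =
      fun ω => (A ω ^ 2 + B ω ^ 2) + boolSign (ω i) * (2 * A ω * B ω) := by
    funext ω
    linear_combination B ω ^ 2 * boolSign_sq (ω i)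
  rw [h1, cubeMean_add_sign_mul (A := fun ω => A ω ^ 2 + B ω ^ 2)
    (B := fun ω => 2 * A ω * B ω) (fun ω => by simp only [hA ω, hB ω]), cubeMean_add]

theorem cubeMean_add_sign_mul_pow_four {i : ι} {A B : (ι → Bool) → ℝ} (hA : FlipInvariant i A)
    (hB : FlipInvariant i B) :
    cubeMean (fun ω => (A ω + boolSign (ω i) * B ω) ^ 4) =
      cubeMean (fun ω => A ω ^ 4) + 6 * cubeMean (fun ω => A ω ^ 2 * B ω ^ 2) +
        cubeMean (fun ω => B ω ^ 4) := by
  have h1 : (fun ω => (A ω + boolSign (ω i) * B ω) ^ 4) =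
      fun ω => (A ω ^ 4 + 6 * (A ω ^ 2 * B ω ^ 2) + B ω ^ 4) +
        boolSign (ω i) * (4 * A ω ^ 3 * B ω + 4 * A ω * B ω ^ 3) := by
    funext ω
    linear_combination (6 * A ω ^ 2 * B ω ^ 2 + 4 * A ω * B ω ^ 3 * boolSign (ω i) +
      B ω ^ 4 * (boolSign (ω i) ^ 2 + 1)) * boolSign_sq (ω i)
  rw [h1, cubeMean_add_sign_mul (A := fun ω => A ω ^ 4 + 6 * (A ω ^ 2 * B ω ^ 2) + B ω ^ 4)
    (B := fun ω => 4 * A ω ^ 3 * B ω + 4 * A ω * B ω ^ 3) (fun ω => by simp only [hA ω, hB ω]),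
    cubeMean_add (fun ω => A ω ^ 4 + 6 * (A ω ^ 2 * B ω ^ 2)), cubeMean_add (fun ω => A ω ^ 4),
    cubeMean_const_mul]

theorem cubeMean_quadraticChaos {m : ι → ι → ℝ} (hm : ∀ e, m e e = 0) (s : Finset ι) :
    cubeMean (quadraticChaos m s) = 0 := by
  induction s using Finset.induction_on with
  | empty => simp [cubeMean, quadraticChaos]
  | insert i s hi ih =>
    rw [quadraticChaos_insert hm hi, cubeMean_add_sign_mul (linearChaos_flipInvariant _ hi), ih]

/-- Induction through `3 * P ^ 2 + 6 * P * a ^ 2 + a ^ 4 ≤ 3 * (P + a ^ 2) ^ 2`. -/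
theorem cubeMean_linearChaos_pow_four_le (a : ι → ℝ) (s : Finset ι) :
    cubeMean (fun ω => linearChaos a s ω ^ 4) ≤
      3 * cubeMean (fun ω => linearChaos a s ω ^ 2) ^ 2 := by
  induction s using Finset.induction_on with
  | empty => simp [cubeMean, linearChaos]
  | insert i s hi ih =>
    have h1 : linearChaos a (insert i s) = fun ω =>
        linearChaos a s ω + boolSign (ω i) * (fun _ => a i) ω := by
      funext ω
      simp only [linearChaos, sum_insert hi]
      ring
    have hA := linearChaos_flipInvariant a hi
    have hB : FlipInvariant i (fun _ : ι → Bool => a i) := fun _ => rfl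
    rw [h1, cubeMean_add_sign_mul_pow_four hA hB, cubeMean_add_sign_mul_sq hA hB]
    have h2 : cubeMean (fun ω : ι → Bool => linearChaos a s ω ^ 2 * a i ^ 2) =
        a i ^ 2 * cubeMean (fun ω : ι → Bool => linearChaos a s ω ^ 2) := by
      rw [← cubeMean_const_mul]
      simp only [mul_comm]
    have h3 : ∀ c : ℝ, cubeMean (fun _ : ι → Bool => c) = c := by
      intro c
      simp [cubeMean]
    rw [h2, h3, h3]
    nlinarith [sq_nonneg (a i ^ 2)]

/-- Hypercontractivity for quadratic Rademacher chaos. -/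
theorem cubeMean_quadraticChaos_pow_four_le {m : ι → ι → ℝ} (hm : ∀ e, m e e = 0)
    (s : Finset ι) : cubeMean (fun ω => quadraticChaos m s ω ^ 4) ≤
      27 * cubeMean (fun ω => quadraticChaos m s ω ^ 2) ^ 2 := by
  induction s using Finset.induction_on with
  | empty => simp [cubeMean, quadraticChaos]
  | insert i s hi ih =>
    set L := linearChaos (fun e => m i e + m e i) s with hL
    have hA := quadraticChaos_flipInvariant m hi
    have hB : FlipInvariant i L := linearChaos_flipInvariant _ hi
    rw [quadraticChaos_insert hm hi, cubeMean_add_sign_mul_pow_four hA hB,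
      cubeMean_add_sign_mul_sq hA hB]
    have hL4 : cubeMean (fun ω => L ω ^ 4) ≤ 3 * cubeMean (fun ω => L ω ^ 2) ^ 2 :=
      cubeMean_linearChaos_pow_four_le _ s
    have hcs := cubeMean_mul_sq_le (fun ω => quadraticChaos m s ω ^ 2) fun ω => L ω ^ 2
    simp only [← pow_mul, Nat.reduceMul] at hcs
    have p0 : 0 ≤ cubeMean (fun ω => quadraticChaos m s ω ^ 2) :=
      cubeMean_nonneg fun ω => sq_nonneg _
    have q0 : 0 ≤ cubeMean (fun ω => L ω ^ 2) := cubeMean_nonneg fun ω => sq_nonneg _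
    have q4 : 0 ≤ cubeMean (fun ω => L ω ^ 4) := cubeMean_nonneg fun ω => by positivity
    set P := cubeMean (fun ω => quadraticChaos m s ω ^ 2)
    set R := cubeMean (fun ω => L ω ^ 2)
    -- The constant `9` is the square root of `27 * 3`; then `27 * P ^ 2 + 54 * P * R + 3 * R ^ 2 ≤
    -- 27 * (P + R) ^ 2`.
    have hle : cubeMean (fun ω => quadraticChaos m s ω ^ 2 * L ω ^ 2) ≤ 9 * (P * R) := by
      refine le_of_pow_le_pow_left₀ (n := 2) (by norm_num) (by positivity) ?_
      calc _ ≤ _ := hcs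
        _ ≤ (27 * P ^ 2) * (3 * R ^ 2) := mul_le_mul ih hL4 q4 (by positivity)
        _ = (9 * (P * R)) ^ 2 := by ring
    nlinarith [sq_nonneg R]

/-- A function whose mean vanishes and whose fourth moment is controlled by its variance is
positive on a substantial part of the cube. -/
theorem cubeMean_pos_ge {X : (ι → Bool) → ℝ} (h1 : cubeMean X = 0)
    (h2 : 0 < cubeMean fun ω => X ω ^ 2)
    (h4 : (cubeMean fun ω => X ω ^ 4) ≤ 27 * (cubeMean fun ω => X ω ^ 2) ^ 2) :
    22 / 2401 ≤ cubeMean fun ω => if 0 < X ω then 1 else 0 := by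
  set V := cubeMean fun ω => X ω ^ 2 with hV
  -- Rescales `X` to second moment `t = 1/49`, close to the maximiser `1/54` of `t - 27 * t ^ 2`;
  -- the resulting bound is `22/2401`.
  set c := (7 * Real.sqrt V)⁻¹ with hc
  have hs : Real.sqrt V ^ 2 = V := Real.sq_sqrt h2.le
  have hs0 : 0 < Real.sqrt V := Real.sqrt_pos.2 h2
  have hc0 : 0 < c := by positivity
  have hcV : c ^ 2 * V = 1 / 49 := by
    rw [hc, inv_pow, mul_pow, hs]
    field_simp
    norm_num
  -- The linear term has mean zero and serves only to make the quartic nonpositive for `u ≤ 0`.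
  -- There the cubic factor is smallest at `-u = 1/√3`, approximated by `29/50`.
  have key : ∀ u : ℝ, 2 / 5 * u + (u ^ 2 + -1 * u ^ 4) ≤ if 0 < u then 1 else 0 := by
    intro u
    split_ifs with hu
    · nlinarith [sq_nonneg (u ^ 2 - 3 / 5), sq_nonneg (u - 4 / 5)]
    · have h0 : 0 ≤ -u := by linarith
      have : 0 ≤ (-u) * ((-u) ^ 3 - (-u) + 2 / 5) := by
        refine mul_nonneg h0 ?_
        nlinarith [mul_nonneg h0 (sq_nonneg (-u - 29 / 50)), sq_nonneg (-u - 29 / 50)]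
      nlinarith
  have h5 : cubeMean (fun ω => 2 / 5 * (c * X ω) + ((c * X ω) ^ 2 + -1 * (c * X ω) ^ 4)) ≤
      cubeMean fun ω => if 0 < X ω then 1 else 0 := by
    refine cubeMean_mono fun ω => (key _).trans (le_of_eq ?_)
    simp only [mul_pos_iff_of_pos_left hc0]
  refine le_trans ?_ h5
  have e1 : (fun ω => 2 / 5 * (c * X ω) + ((c * X ω) ^ 2 + -1 * (c * X ω) ^ 4)) =
      fun ω => 2 / 5 * c * X ω + (c ^ 2 * X ω ^ 2 + (-c ^ 4) * X ω ^ 4) := by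
    funext ω; ring
  rw [e1, cubeMean_add, cubeMean_add, cubeMean_const_mul, cubeMean_const_mul, cubeMean_const_mul,
    h1, ← hV, hcV]
  have h6 : c ^ 4 * cubeMean (fun ω => X ω ^ 4) ≤ 27 / 2401 := by
    calc c ^ 4 * cubeMean (fun ω => X ω ^ 4) ≤ c ^ 4 * (27 * V ^ 2) := by gcongr
      _ = 27 * (c ^ 2 * V) ^ 2 := by ring
      _ = 27 / 2401 := by rw [hcV]; norm_num
  linarith

end cube

/-! ### The score spread of a random tournament. -/

namespace Tournament

open Finset

/-- With at most one edge, `orderSum` has no terms beyond the vanishing linear one, so every bias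
works. -/
theorem not_locallyForcing_of_le_two {h : ℕ} (hh : h ≤ 2) (H : Tournament (Fin h)) :
    ¬ H.LocallyForcing := by
  refine H.not_locallyForcing_of_orderSum_eq (x := 1 / 2) (by norm_num) (by norm_num) ?_
  have hcard : #H.edges ≤ 1 := by
    rw [card_edges, Fintype.card_fin]
    exact Nat.choose_le_choose 2 hh
  have h1 : ∀ π : Equiv.Perm (Fin h), ∏ e ∈ H.edges, (1 + 1 / 2 * ordSign (π e.1) (π e.2)) =
      1 + 1 / 2 * H.orderBalance π := by
    intro π
    by_cases hne : H.edges.Nonempty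
    · obtain ⟨e, he⟩ := card_eq_one.1 (le_antisymm hcard hne.card_pos)
      simp [orderBalance, he]
    · rw [not_nonempty_iff_eq_empty] at hne
      simp [orderBalance, hne]
  rw [orderSum, sum_congr rfl fun π _ => h1 π, sum_add_distrib, ← mul_sum, sum_orderBalance]
  simp [Fintype.card_perm]

/-- The sum of the squared score differences. -/
noncomputable def scoreSpread {h : ℕ} (H : Tournament (Fin h)) : ℝ := ∑ u, (∑ v, H.skew u v) ^ 2

theorem lt_scoreSpread_iff {h : ℕ} (H : Tournament (Fin h)) :
    (h : ℝ) * (h - 1) < H.scoreSpread ↔ (h : ℤ) * ((h : ℤ) - 1) <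
      ∑ v : Fin h, ((H.outDegree v : ℤ) - (H.inDegree v : ℤ)) ^ 2 := by
  have h1 : H.scoreSpread =
      ((∑ v : Fin h, ((H.outDegree v : ℤ) - (H.inDegree v : ℤ)) ^ 2 : ℤ) : ℝ) := by
    push_cast
    exact sum_congr rfl fun u _ => by rw [sum_skew]
  have h2 : (h : ℝ) * (h - 1) = (((h : ℤ) * ((h : ℤ) - 1) : ℤ) : ℝ) := by push_cast; ring
  rw [h1, h2, Int.cast_lt]

variable {h : ℕ}

/-- The incidence matrix of the complete graph with its edges directed upwards. -/
noncomputable def incidence (u : Fin h) (e : Pairs h) : ℝ :=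
  (if e.1.1 = u then 1 else 0) - (if e.1.2 = u then 1 else 0)

theorem skew_ofOrientation (ω : Pairs h → Bool) (u v : Fin h) :
    (ofOrientation ω).skew u v =
      ∑ e : Pairs h, ((if e.1.1 = u then if e.1.2 = v then 1 else 0 else 0) -
        (if e.1.2 = u then if e.1.1 = v then 1 else 0 else 0)) * boolSign (ω e) := by
  have key : ∀ {u v : Fin h}, u < v → (ofOrientation ω).skew u v =
      ∑ e : Pairs h, ((if e.1.1 = u then if e.1.2 = v then 1 else 0 else 0) -
        (if e.1.2 = u then if e.1.1 = v then 1 else 0 else 0)) * boolSign (ω e) := by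
    intro u v huv
    rw [sum_eq_single ⟨(u, v), huv⟩]
    · simp only [skew, adjMatrix, ofOrientation_adj_of_lt ω huv, ofOrientation_adj_of_gt ω huv]
      cases hω : ω ⟨(u, v), huv⟩ <;> simp [boolSign, huv.ne']
    · rintro ⟨⟨a, b⟩, hab⟩ - hne
      simp only [ne_eq, Subtype.mk.injEq, Prod.mk.injEq, not_and] at hne
      have h2 : ¬ (b = u ∧ a = v) := by
        rintro ⟨rfl, rfl⟩
        exact absurd huv hab.not_gt
      simp only [← ite_and]
      rw [if_neg (by simpa using hne), if_neg h2]
      simp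
    · simp
  rcases lt_trichotomy u v with huv | huv | huv
  · exact key huv
  · subst huv
    rw [skew_self]
    symm
    refine sum_eq_zero fun e _ => ?_
    simp only [← ite_and, and_comm, sub_self, zero_mul]
  · rw [skew_swap, key huv, ← sum_neg_distrib]
    refine sum_congr rfl fun e _ => ?_
    simp only [← ite_and, and_comm (a := e.1.1 = v), and_comm (a := e.1.2 = v)]
    ring

theorem sum_skew_ofOrientation (ω : Pairs h → Bool) (u : Fin h) :
    ∑ v, (ofOrientation ω).skew u v = ∑ e, incidence u e * boolSign (ω e) := by
  simp only [skew_ofOrientation]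
  rw [sum_comm]
  refine sum_congr rfl fun e _ => ?_
  rw [← sum_mul, sum_sub_distrib]
  simp only [sum_ite_irrel, sum_const_zero, sum_ite_eq, mem_univ, if_true, incidence]

theorem sum_incidence_sq (e : Pairs h) : ∑ u, incidence u e * incidence u e = 2 := by
  have hne : e.1.1 ≠ e.1.2 := e.2.ne
  have : ∀ u, incidence u e * incidence u e =
      (if e.1.1 = u then 1 else 0) + (if e.1.2 = u then 1 else 0) := by
    intro u
    unfold incidence
    by_cases h1 : e.1.1 = u
    · have h2 : e.1.2 ≠ u := fun h2 => hne (h1.trans h2.symm)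
      simp [h1, h2]
    · by_cases h2 : e.1.2 = u <;> simp [h1, h2]
  simp only [this, sum_add_distrib, sum_ite_eq, mem_univ, if_true]
  norm_num

/-- The coefficients of the centred score spread as a quadratic form in the edge signs. -/
noncomputable def pairCoeff (e e' : Pairs h) : ℝ :=
  if e = e' then 0 else ∑ u, incidence u e * incidence u e'

/-- Signs square to `1` and each incidence column has squared norm `2`, so the diagonal contributes
exactly `h(h-1)`. -/
theorem scoreSpread_ofOrientation (ω : Pairs h → Bool) :
    (ofOrientation ω).scoreSpread = (h : ℝ) * (h - 1) + quadraticChaos pairCoeff univ ω := by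
  have h1 : (ofOrientation ω).scoreSpread = ∑ e, ∑ e', (∑ u, incidence u e * incidence u e') *
      (boolSign (ω e) * boolSign (ω e')) := by
    simp only [scoreSpread, sum_skew_ofOrientation, sq, sum_mul_sum]
    rw [sum_comm]
    refine sum_congr rfl fun e _ => ?_
    rw [sum_comm]
    refine sum_congr rfl fun e' _ => ?_
    rw [sum_mul]
    refine sum_congr rfl fun u _ => ?_
    ring
  have h2 : ∀ e e' : Pairs h, (∑ u, incidence u e * incidence u e') *
      (boolSign (ω e) * boolSign (ω e')) =
      (if e = e' then 2 else 0) + pairCoeff e e' * (boolSign (ω e) * boolSign (ω e')) := by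
    intro e e'
    unfold pairCoeff
    split_ifs with hee
    · subst hee
      rw [sum_incidence_sq, ← sq, boolSign_sq]; ring
    · ring
  rw [h1, quadraticChaos]
  simp only [h2, sum_add_distrib, sum_ite_eq, mem_univ, if_true, sum_const, card_univ, card_pairs,
    nsmul_eq_mul]
  rw [Nat.cast_choose_two]
  ring

theorem sum_ordSign (u : Fin h) : ∑ v, ordSign u v = (h : ℝ) - 1 - 2 * (u : ℕ) := by
  have h1 : ∀ v : Fin h, ordSign u v =
      (if u < v then 1 else 0) - (if v < u then 1 else 0) := by
    intro v
    rcases lt_trichotomy u v with h | h | h <;> simp [ordSign, h, h.not_gt]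
  simp only [h1, sum_sub_distrib, sum_boole]
  have h2 : (univ.filter fun v => u < v) = Finset.Ioi u := by ext; simp
  have h3 : (univ.filter fun v => v < u) = Finset.Iio u := by ext; simp
  rw [h2, h3, Fin.card_Ioi, Fin.card_Iio, Nat.sub_sub, Nat.cast_sub (by omega)]
  push_cast
  ring

theorem sum_range_sq_sub (a : ℝ) (n : ℕ) : ∑ i ∈ range n, (a - 2 * (i : ℝ)) ^ 2 =
    n * a ^ 2 - 2 * a * (n * (n - 1)) + 2 / 3 * (n * (n - 1) * (2 * n - 1)) := by
  induction n with
  | zero => simp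
  | succ n ih => rw [sum_range_succ, ih]; push_cast; ring

/-- Ensures a nonzero variance: the transitive tournament has spread `h(h-1)(h+1)/3`, which exceeds
`h(h-1)` for `h ≥ 3`. -/
theorem quadraticChaos_pairCoeff_pos (hh : 3 ≤ h) :
    0 < quadraticChaos (pairCoeff (h := h)) univ fun _ => true := by
  have h1 := scoreSpread_ofOrientation (h := h) fun _ => true
  have h2 : ∀ u v : Fin h, (ofOrientation (n := h) fun _ => true).skew u v = ordSign u v := by
    intro u v
    rcases lt_trichotomy u v with h | h | h
    · simp [skew, adjMatrix, ordSign, ofOrientation, h, h.not_gt]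
    · rw [h, skew_self, ordSign_self]
    · simp [skew, adjMatrix, ordSign, ofOrientation, h, h.not_gt]
  have h3 : (ofOrientation (n := h) fun _ => true).scoreSpread =
      (h : ℝ) * (h - 1) * (h + 1) / 3 := by
    simp only [scoreSpread, h2, sum_ordSign]
    rw [Fin.sum_univ_eq_sum_range (fun i => ((h : ℝ) - 1 - 2 * (i : ℝ)) ^ 2), sum_range_sq_sub]
    ring
  have hh' : (3 : ℝ) ≤ h := by exact_mod_cast hh
  have h4 : 0 < (h : ℝ) * (h - 1) * (h - 2) :=
    mul_pos (mul_pos (by linarith) (by linarith)) (by linarith)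
  nlinarith

theorem spread_prob_ge (hh : 3 ≤ h) [DecidablePred fun ω : Pairs h → Bool =>
      (h : ℝ) * (h - 1) < (ofOrientation ω).scoreSpread] :
    22 / 2401 ≤ (#{ω : Pairs h → Bool | (h : ℝ) * (h - 1) < (ofOrientation ω).scoreSpread} : ℝ) /
      2 ^ h.choose 2 := by
  have hm : ∀ e : Pairs h, pairCoeff e e = 0 := fun e => if_pos rfl
  have h1 := cubeMean_pos_ge (cubeMean_quadraticChaos hm univ)
    (cubeMean_pos (fun ω => sq_nonneg _) (pow_pos (quadraticChaos_pairCoeff_pos hh) 2))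
    (cubeMean_quadraticChaos_pow_four_le hm univ)
  refine h1.trans (le_of_eq ?_)
  rw [cubeMean, card_pairs, sum_boole]
  congr 3
  ext ω
  simp [scoreSpread_ofOrientation]

theorem card_transitive_le [DecidablePred fun ω : Pairs h → Bool =>
      ∃ σ : Equiv.Perm (Fin h), ∀ u v, (ofOrientation ω).Adj u v → σ u < σ v] :
    #{ω : Pairs h → Bool | ∃ σ : Equiv.Perm (Fin h), ∀ u v, (ofOrientation ω).Adj u v → σ u < σ v} ≤
      h.factorial := by
  have hf : h.factorial = #(univ : Finset (Equiv.Perm (Fin h))) := by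
    rw [card_univ, Fintype.card_perm, Fintype.card_fin]
  rw [hf]
  refine (card_le_card (t := univ.image fun (σ : Equiv.Perm (Fin h)) (e : Pairs h) =>
    decide (σ e.1.1 < σ e.1.2)) ?_).trans card_image_le
  intro ω hω
  obtain ⟨σ, hσ⟩ := (mem_filter.1 hω).2
  refine mem_image.2 ⟨σ, mem_univ _, ?_⟩
  funext e
  cases hω : ω e
  · exact decide_eq_false (hσ _ _ ((ofOrientation_adj_of_gt ω e.2).2 hω)).not_gt
  · exact decide_eq_true (hσ _ _ ((ofOrientation_adj_of_lt ω e.2).2 hω))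

/-- The constant suffices because `22/2401 - 1/400 > 1/205`. The inequality fails for `h = 6`, hence
the separate small cases. -/
theorem factorial_le_two_pow (hh : 7 ≤ h) : (400 * h.factorial : ℝ) ≤ 2 ^ h.choose 2 := by
  suffices 400 * h.factorial ≤ 2 ^ h.choose 2 by exact_mod_cast this
  induction h, hh using Nat.le_induction with
  | base => decide
  | succ n hn ih =>
    have h1 : (n + 1).choose 2 = n + n.choose 2 := by
      rw [Nat.choose_succ_succ' n 1, Nat.choose_one_right]
    rw [h1, pow_add, Nat.factorial_succ]
    have h2 : n + 1 ≤ 2 ^ n := Nat.lt_two_pow_self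
    calc 400 * ((n + 1) * n.factorial) = (n + 1) * (400 * n.factorial) := by ring
      _ ≤ 2 ^ n * 2 ^ n.choose 2 := Nat.mul_le_mul h2 ih

theorem not_locallyForcing_prob_ge_of_seven_le (hh : 7 ≤ h)
    [DecidablePred fun ω : Pairs h → Bool => ¬ (ofOrientation ω).LocallyForcing] :
    (1 / 205 : ℝ) ≤ (#{ω : Pairs h → Bool | ¬ (ofOrientation ω).LocallyForcing} : ℝ) /
      2 ^ h.choose 2 := by
  classical
  have h1 := spread_prob_ge (h := h) (by omega)
  have h2 := card_transitive_le (h := h)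
  have h3 := factorial_le_two_pow hh
  set A : Finset (Pairs h → Bool) :=
    {ω : Pairs h → Bool | (h : ℝ) * (h - 1) < (ofOrientation ω).scoreSpread} with hA
  set B : Finset (Pairs h → Bool) := {ω : Pairs h → Bool | ∃ σ : Equiv.Perm (Fin h),
    ∀ u v, (ofOrientation ω).Adj u v → σ u < σ v} with hB
  set C : Finset (Pairs h → Bool) := {ω : Pairs h → Bool | ¬ (ofOrientation ω).LocallyForcing}
  have hsub : A ⊆ C ∪ B := by
    intro ω hω
    by_cases hb : ω ∈ B
    · exact mem_union_right _ hb
    · refine mem_union_left _ (mem_filter.2 ⟨mem_univ _, ?_⟩)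
      exact not_locallyForcing_of_scores _ (mem_filter.1 hω).2 fun hσ =>
        hb (mem_filter.2 ⟨mem_univ _, hσ⟩)
  have h4 : (#A : ℝ) ≤ #C + #B := by
    exact_mod_cast (card_le_card hsub).trans (card_union_le _ _)
  have h5 : (#B : ℝ) ≤ h.factorial := by exact_mod_cast h2
  have hp : (0 : ℝ) < 2 ^ h.choose 2 := by positivity
  rw [le_div_iff₀ hp] at h1 ⊢
  linarith

end Tournament

/-! ### Explicit families on five and six vertices. -/

namespace Tournament

open Finset

variable {h : ℕ}

/-- The entries of the skew adjacency matrix of the tournament on initial segments of `ℕ` in which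
`i < j` is directed upwards exactly when `t i j` is true. -/
def skewTable (t : ℕ → ℕ → Bool) (i j : ℕ) : ℤ :=
  if i < j then (if t i j then 1 else -1) else if j < i then (if t j i then -1 else 1) else 0

/-- The orientation of the complete graph given by a table of bits. -/
def tableOrientation (t : ℕ → ℕ → Bool) (e : Pairs h) : Bool := t e.1.1 e.1.2

theorem skew_tableOrientation (t : ℕ → ℕ → Bool) (u v : Fin h) :
    (ofOrientation (tableOrientation t)).skew u v = (skewTable t u v : ℝ) := by
  rcases lt_trichotomy u v with huv | huv | huv
  · have : (u : ℕ) < v := huv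
    simp only [skew, adjMatrix, ofOrientation_adj_of_lt _ huv, ofOrientation_adj_of_gt _ huv,
      tableOrientation, skewTable, if_pos this]
    cases t u v <;> simp
  · subst huv
    simp [skew_self, skewTable]
  · have : (v : ℕ) < u := huv
    simp only [skew, adjMatrix, ofOrientation_adj_of_lt _ huv, ofOrientation_adj_of_gt _ huv,
      tableOrientation, skewTable, if_pos this, if_neg this.not_gt]
    cases t v u <;> simp

/-- A tournament with spread scores and a cyclic triangle on the vertices `1, 2, 3` is not locally
forcing. -/
theorem not_locallyForcing_tableOrientation (t : ℕ → ℕ → Bool) (hh : 4 ≤ h)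
    (hQ : (h : ℤ) * (h - 1) < ∑ u : Fin h, (∑ v : Fin h, skewTable t u v) ^ 2)
    (h12 : t 2 3 = t 1 2) (h13 : t 1 3 = !t 1 2) :
    ¬ (ofOrientation (tableOrientation (h := h) t)).LocallyForcing := by
  apply not_locallyForcing_of_scores
  · simp only [skew_tableOrientation]
    exact_mod_cast hQ
  · rintro ⟨σ, hσ⟩
    let a : Fin h := ⟨1, by omega⟩
    let b : Fin h := ⟨2, by omega⟩
    let c : Fin h := ⟨3, by omega⟩
    have hab : a < b := Fin.mk_lt_mk.2 (by norm_num)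
    have hbc : b < c := Fin.mk_lt_mk.2 (by norm_num)
    have hac : a < c := Fin.mk_lt_mk.2 (by norm_num)
    cases ht : t 1 2
    · have h1 := hσ b a ((ofOrientation_adj_of_gt _ hab).2 ht)
      have h2 := hσ c b ((ofOrientation_adj_of_gt _ hbc).2 (h12.trans ht))
      have h3 := hσ a c ((ofOrientation_adj_of_lt _ hac).2 (h13.trans (by rw [ht]; rfl)))
      exact absurd (h1.trans h3) h2.not_gt
    · have h1 := hσ a b ((ofOrientation_adj_of_lt _ hab).2 ht)
      have h2 := hσ b c ((ofOrientation_adj_of_lt _ hbc).2 (h12.trans ht))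
      have h3 := hσ c a ((ofOrientation_adj_of_gt _ hac).2 (h13.trans (by rw [ht]; rfl)))
      exact absurd (h1.trans h2) h3.not_gt

/-- A family of tournaments on `6` vertices: vertex `0` is joined in the same way to all others,
the vertices `1, 2, 3` form a cyclic triangle, and vertex `4` has an odd number of out-neighbours
among `1, 2, 3, 5`. -/
def bitTable (b0 b1 b2 b3 b4 b5 b6 b7 : Bool) : ℕ → ℕ → Bool
  | 0, _ => b0
  | 1, 2 => b1
  | 2, 3 => b1
  | 1, 3 => !b1
  | 1, 4 => b2
  | 2, 4 => b3
  | 3, 4 => b4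
  | 1, 5 => b5
  | 2, 5 => b6
  | 3, 5 => b7
  | 4, 5 => xor b2 (xor b3 b4)
  | _, _ => true

-- Let `s i` be the score differences within `{1, 2, 3, 4}`. As vertex `0` dominates, the spread is
-- `16 + 4 + ∑ (s i) ^ 2`, and each `s i` is odd.
set_option maxRecDepth 100000 in
theorem bitTable_spread_five : ∀ b1 b2 b3 : Bool, ((5 : ℕ) : ℤ) * ((5 : ℕ) - 1) <
    ∑ u : Fin 5, (∑ v : Fin 5, skewTable (bitTable true b1 b2 b3 true true true true) u v) ^ 2 := by
  decide

-- Here the spread is `25 + 5 + ∑ (s i) ^ 2` with `s i` taken within `{1, ..., 5}`. The parity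
-- condition at vertex `4` forces `s 4 = ±2`, so the inequality is strict.
set_option maxRecDepth 100000 in
theorem bitTable_spread_six : ∀ b0 b1 b2 b3 b4 b5 b6 b7 : Bool, ((6 : ℕ) : ℤ) * ((6 : ℕ) - 1) <
    ∑ u : Fin 6, (∑ v : Fin 6, skewTable (bitTable b0 b1 b2 b3 b4 b5 b6 b7) u v) ^ 2 := by
  decide

theorem two_pow_le_card_of_injective {k : ℕ} {P : (Pairs h → Bool) → Prop} [DecidablePred P]
    (g : (Fin k → Bool) → Pairs h → Bool) (hg : Function.Injective g) (hP : ∀ b, P (g b)) :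
    2 ^ k ≤ #{ω | P ω} := by
  have : 2 ^ k = #(univ.image g) := by
    rw [card_image_of_injective _ hg]; simp
  rw [this]
  refine card_le_card fun ω hω => ?_
  obtain ⟨b, -, rfl⟩ := mem_image.1 hω
  exact mem_filter.2 ⟨mem_univ _, hP b⟩

theorem eight_le_card_not_locallyForcing_five
    [DecidablePred fun ω : Pairs 5 → Bool => ¬ (ofOrientation ω).LocallyForcing] :
    2 ^ 3 ≤ #{ω : Pairs 5 → Bool | ¬ (ofOrientation ω).LocallyForcing} := by
  refine two_pow_le_card_of_injective (fun b : Fin 3 → Bool => tableOrientation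
    (bitTable true (b 0) (b 1) (b 2) true true true true)) ?_ ?_
  · intro b c hbc
    have e0 := congrFun hbc ⟨(1, 2), by decide⟩
    have e1 := congrFun hbc ⟨(1, 4), by decide⟩
    have e2 := congrFun hbc ⟨(2, 4), by decide⟩
    funext i
    fin_cases i
    exacts [e0, e1, e2]
  · exact fun b => not_locallyForcing_tableOrientation _ (by norm_num)
      (bitTable_spread_five _ _ _) rfl rfl

theorem card_not_locallyForcing_six
    [DecidablePred fun ω : Pairs 6 → Bool => ¬ (ofOrientation ω).LocallyForcing] :
    2 ^ 8 ≤ #{ω : Pairs 6 → Bool | ¬ (ofOrientation ω).LocallyForcing} := by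
  refine two_pow_le_card_of_injective (fun b : Fin 8 → Bool => tableOrientation
    (bitTable (b 0) (b 1) (b 2) (b 3) (b 4) (b 5) (b 6) (b 7))) ?_ ?_
  · intro b c hbc
    have e0 := congrFun hbc ⟨(0, 1), by decide⟩
    have e1 := congrFun hbc ⟨(1, 2), by decide⟩
    have e2 := congrFun hbc ⟨(1, 4), by decide⟩
    have e3 := congrFun hbc ⟨(2, 4), by decide⟩
    have e4 := congrFun hbc ⟨(3, 4), by decide⟩
    have e5 := congrFun hbc ⟨(1, 5), by decide⟩
    have e6 := congrFun hbc ⟨(2, 5), by decide⟩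
    have e7 := congrFun hbc ⟨(3, 5), by decide⟩
    funext i
    fin_cases i
    exacts [e0, e1, e2, e3, e4, e5, e6, e7]
  · exact fun b => not_locallyForcing_tableOrientation _ (by norm_num)
      (bitTable_spread_six _ _ _ _ _ _ _ _) rfl rfl

end Tournament

/-! ### Assembly of both probability bounds. -/

theorem mainTheorem5 :
    (∀ h : ℕ, h ≠ 3 → h ≠ 4 →
      (1 / 205 : ℝ) ≤ (Tournament.randomTournament h probHalf).real
        {H : Tournament (Fin h) | ¬ H.LocallyForcing}) ∧
    (∀ h : ℕ, 3 ≤ h →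
      (1 / 205 : ℝ) ≤ (Tournament.randomTournament h probHalf).real
        {H : Tournament (Fin h) |
          (h : ℤ) * ((h : ℤ) - 1) <
            ∑ v : Fin h, ((H.outDegree v : ℤ) - (H.inDegree v : ℤ)) ^ 2}) := by
  classical
  refine ⟨fun h h3 h4 => ?_, fun h h3 => ?_⟩
  · by_cases h2 : h ≤ 2
    · have : {H : Tournament (Fin h) | ¬ H.LocallyForcing} = Set.univ :=
        Set.eq_univ_of_forall fun H => H.not_locallyForcing_of_le_two h2
      rw [this, probReal_univ]
      norm_num
    rw [Tournament.randomTournament_half_real]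
    by_cases h7 : 7 ≤ h
    · exact Tournament.not_locallyForcing_prob_ge_of_seven_le h7
    -- Both families have density `2 ^ 3 / 2 ^ 10 = 2 ^ 8 / 2 ^ 15 = 1/128`.
    obtain rfl | rfl : h = 5 ∨ h = 6 := by omega
    · rw [le_div_iff₀ (by positivity)]
      have : ((2 ^ 3 : ℕ) : ℝ) ≤ _ :=
        Nat.cast_le.2 Tournament.eight_le_card_not_locallyForcing_five
      refine le_trans ?_ this
      norm_num [Nat.choose]
    · rw [le_div_iff₀ (by positivity)]
      have : ((2 ^ 8 : ℕ) : ℝ) ≤ _ :=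
        Nat.cast_le.2 Tournament.card_not_locallyForcing_six
      refine le_trans ?_ this
      norm_num [Nat.choose]
  · rw [Tournament.randomTournament_half_real]
    refine le_trans (by norm_num) ((Tournament.spread_prob_ge h3).trans (le_of_eq ?_))
    congr 3
    ext ω
    rw [Finset.mem_filter_univ, Finset.mem_filter_univ]
    exact Tournament.lt_scoreSpread_iff _
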